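/- Let $d\ge 1$ and $k\ge 5$ be integers, $G=\mathbb Z^d$ and $\Sigma_k=\{0,\dots,k-1\}$. Define $p'_0=1$, $q'_0=k$, $p'_{n+1}=p'_nq'_n$, $q'_{n+1}=(q'_n-1)!$, and let $$\lambda(k)=\lim_{n\to\infty}\frac{\log q'_n}{p'_n}$$ (the sequence is non-increasing and bounded below by $0$, so the limit exists). Let $h$ be a real number with $0<h<\lambda(k)$. Then there exists a Toeplitz array $x\in(\Sigma_k)^{G}$, i.e. an array such that for every $g\in G$ there is a finite index subgroup $\Gamma\le G$ with $x(g+\gamma)=x(g)$ for all $\gamma\in\Gamma$, such that its orbit closure $X=\overline{O_G(x)}\subseteq(\Sigma_k)^G$ under the shift action $(gy)(u)=y(u+g)$ has the following properties. 1. $(X,G)$ is strictly ergodic, i.e. minimal with exactly one $G$-invariant Borel probability measure. 2. $h_{\mathrm{top}}(X,G)=h$, i.e. for every Følner sequence $(F_n)$ of non-empty finite subsets of $G$ we have $\frac{1}{\# F_n}\log\theta_{F_n}(X)\to h$, where $\theta_M(X)=\#\{y|_M : y\in X\}$. 3. The maximal equicontinuous factor of $(X,G)$ is the universal $G$-odometer.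 Here a $G$-odometer is an inverse limit $\varprojlim_n G/\Gamma_n$ for a decreasing sequence $(\Gamma_n)$ of finite index subgroups of $G$, with the translation action of $G$; it is universal if every $G$-odometer is a factor of it (such an odometer is unique up to isomorphism). The maximal equicontinuous factor is an equicontinuous factor through which every factor map onto an equicontinuous compact Hausdorff $G$-system factors. -/

import Mathlib

open Filter Topology MeasureTheory

/-! ## The number `λ(k)` -/

/-- The pair `(p'_n, q'_n)`: `p'_0 = 1`, `q'_0 = k`, `p'_{n+1} = p'_n q'_n`,
`q'_{n+1} = (q'_n - 1)!`. -/
def pqSeq (k : ℕ) : ℕ → ℕ × ℕ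
  | 0 => (1, k)
  | n + 1 => ((pqSeq k n).1 * (pqSeq k n).2, ((pqSeq k n).2 - 1).factorial)

/-- `λ_n(k) = log (q'_n) / p'_n`. -/
noncomputable def lambdaSeq (k n : ℕ) : ℝ :=
  Real.log ((pqSeq k n).2 : ℝ) / ((pqSeq k n).1 : ℝ)

/-- `λ(k) = lim_n λ_n(k)`; the limit exists for `k ≥ 5`, see `tendsto_lambdaSeq`. -/
noncomputable def lambdaLim (k : ℕ) : ℝ :=
  limUnder atTop (lambdaSeq k)

theorem pqSeq_pos {k : ℕ} (hk : 5 ≤ k) (n : ℕ) : 0 < (pqSeq k n).1 ∧ 0 < (pqSeq k n).2 := by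
  induction n with
  | zero => exact ⟨Nat.one_pos, by simp only [pqSeq]; omega⟩
  | succ n ih => exact ⟨Nat.mul_pos ih.1 ih.2, Nat.factorial_pos _⟩

theorem lambdaSeq_antitone {k : ℕ} (hk : 5 ≤ k) : Antitone (lambdaSeq k) := by
  refine antitone_nat_of_succ_le fun n => ?_
  obtain ⟨hp, hq⟩ := pqSeq_pos hk n
  simp only [lambdaSeq, pqSeq]
  generalize (pqSeq k n).1 = p at *
  generalize (pqSeq k n).2 = q at *
  have hp' : (0 : ℝ) < p := by exact_mod_cast hp
  have hq' : (0 : ℝ) < q := by exact_mod_cast hq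
  have h1 : (((q - 1).factorial : ℕ) : ℝ) ≤ (q : ℝ) ^ q := by
    have h2 : (q - 1).factorial ≤ q ^ q :=
      (Nat.factorial_le (Nat.sub_le q 1)).trans (Nat.factorial_le_pow q)
    exact_mod_cast h2
  have h3 : Real.log (((q - 1).factorial : ℕ) : ℝ) ≤ q * Real.log q := by
    have h4 := Real.log_le_log (by exact_mod_cast Nat.factorial_pos (q - 1)) h1
    rwa [Real.log_pow] at h4
  push_cast
  rw [div_le_div_iff₀ (by positivity) hp']
  nlinarith

theorem lambdaSeq_bddBelow (k : ℕ) : BddBelow (Set.range (lambdaSeq k)) := by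
  refine ⟨0, ?_⟩
  rintro _ ⟨n, rfl⟩
  exact div_nonneg (Real.log_natCast_nonneg _) (Nat.cast_nonneg _)

theorem tendsto_lambdaSeq {k : ℕ} (hk : 5 ≤ k) :
    Tendsto (lambdaSeq k) atTop (𝓝 (lambdaLim k)) :=
  tendsto_nhds_limUnder ⟨_, tendsto_atTop_ciInf (lambdaSeq_antitone hk) (lambdaSeq_bddBelow k)⟩

/-! ## Topological dynamical systems

A system is a compact Hausdorff space `X` with a continuous action of a countable discrete
abelian group `G`. -/

/-- `f` is a factor map: continuous, surjective and equivariant. -/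
structure IsFactorMap (G : Type*) [AddCommGroup G] {X Y : Type*}
    [TopologicalSpace X] [AddAction G X] [TopologicalSpace Y] [AddAction G Y]
    (f : X → Y) : Prop where
  continuous : Continuous f
  surjective : Function.Surjective f
  equivariant : ∀ (g : G) (x : X), f (g +ᵥ x) = g +ᵥ f x

/-- The system `(X, G)` has exactly one invariant Borel probability measure. -/
def IsUniquelyErgodic (G : Type*) [AddCommGroup G] (X : Type*)
    [TopologicalSpace X] [AddAction G X] : Prop :=
  letI : MeasurableSpace X := borel X
  ∃! μ : Measure X, IsProbabilityMeasure μ ∧ VAddInvariantMeasure G X μ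

/-- Minimal and uniquely ergodic. -/
def IsStrictlyErgodic (G : Type*) [AddCommGroup G] (X : Type*)
    [TopologicalSpace X] [AddAction G X] : Prop :=
  AddAction.IsMinimal G X ∧ IsUniquelyErgodic G X

/-- The system `(X, G)` is equicontinuous: the translations `x ↦ g + x` form a uniformly
equicontinuous family for the unique uniform structure inducing the topology of the compact
Hausdorff space `X`. -/
def IsEquicontinuousSystem (G : Type*) [AddCommGroup G] (X : Type*)
    [TopologicalSpace X] [CompactSpace X] [T2Space X] [AddAction G X] : Prop :=
  letI : UniformSpace X := uniformSpaceOfCompactR1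
  UniformEquicontinuous (fun (g : G) (x : X) => g +ᵥ x)

/-- `π : X → Y` is the maximal equicontinuous factor of `(X, G)`: it is an equicontinuous factor,
and every equicontinuous factor of `(X, G)` factors through it. (Every factor of `X` is conjugate
to one in the universe of `X`.) -/
structure IsMaximalEquicontinuousFactor (G : Type) [AddCommGroup G] {X Y : Type}
    [TopologicalSpace X] [AddAction G X]
    [TopologicalSpace Y] [CompactSpace Y] [T2Space Y] [AddAction G Y]
    (π : X → Y) : Prop where
  isFactorMap : IsFactorMap G π
  equicontinuous : IsEquicontinuousSystem G Y
  maximal : ∀ (Z : Type) [TopologicalSpace Z] [CompactSpace Z] [T2Space Z] [AddAction G Z]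
    [ContinuousConstVAdd G Z], IsEquicontinuousSystem G Z →
    ∀ f : X → Z, IsFactorMap G f → ∃ ψ : Y → Z, IsFactorMap G ψ ∧ f = ψ ∘ π

/-! ## Subshifts -/

section Subshifts

open SymbolicDynamics.FullShift

variable {G : Type*} [AddCommGroup G] {A : Type*} [TopologicalSpace A]

/-- A subshift as a system, with the action `(g + y)(h) = y (g + h)`. -/
instance subshiftAddAction (X : Subshift A G) : AddAction G X.carrier where
  vadd g y := ⟨shift g y.1, X.mapsTo g y.2⟩
  zero_vadd y := Subtype.ext (shift_zero y.1)
  add_vadd g h y := Subtype.ext (by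
    change shift (g + h) y.1 = shift g (shift h y.1)
    rw [add_comm, shift_add])

instance subshiftContinuous (X : Subshift A G) : ContinuousConstVAdd G X.carrier where
  continuous_const_vadd g :=
    ((continuous_shift g).comp continuous_subtype_val).subtype_mk _

/-- The orbit closure of an array `x`, as a subshift. -/
def orbitClosure (x : G → A) : Subshift A G where
  carrier := closure (Set.range fun g : G => shift g x)
  isClosed := isClosed_closure
  mapsTo g := by
    refine Set.MapsTo.closure ?_ (continuous_shift g)
    rintro _ ⟨h, rfl⟩
    exact ⟨h + g, shift_add h g x⟩

/-- `x` is a Toeplitz array: for every `g` there is a finite index subgroup `Γ` with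
`x (g + γ) = x g` for all `γ ∈ Γ`. -/
def IsToeplitzArray {G A : Type*} [AddCommGroup G] (x : G → A) : Prop :=
  ∀ g : G, ∃ Γ : AddSubgroup G, Γ.FiniteIndex ∧ ∀ γ ∈ Γ, x (g + γ) = x g

/-- `θ_M(X)`: the number of `M`-blocks that occur in `X`. -/
noncomputable def blockCount (X : Subshift A G) (M : Finset G) : ℕ :=
  ((fun y : G → A => M.restrict y) '' X.carrier).ncard

open scoped Classical Pointwise in
/-- `F` is a Følner sequence of (non-empty) finite subsets of `G`. -/
def IsFolnerSequence {G : Type*} [AddCommGroup G] (F : ℕ → Finset G) : Prop :=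
  (∀ n, (F n).Nonempty) ∧
    ∀ g : G, Tendsto (fun n => ((symmDiff (g +ᵥ F n) (F n)).card : ℝ) / ((F n).card : ℝ))
      atTop (𝓝 0)

/-- `h_top(X, G) = h`, i.e. `log θ_{F_n}(X) / #F_n → h` for every Følner sequence `F`. -/
def HasTopologicalEntropy (X : Subshift A G) (h : ℝ) : Prop :=
  ∀ F : ℕ → Finset G, IsFolnerSequence F →
    Tendsto (fun n => Real.log (blockCount X (F n) : ℝ) / ((F n).card : ℝ)) atTop (𝓝 h)

end Subshifts

/-! ## Odometers -/

/-- A decreasing sequence of finite index subgroups of `G`. -/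
structure SubgroupChain (G : Type*) [AddCommGroup G] where
  Γ : ℕ → AddSubgroup G
  anti : ∀ n, Γ (n + 1) ≤ Γ n
  finiteIndex : ∀ n, (Γ n).FiniteIndex

section Odometers

variable {G : Type*} [AddCommGroup G]

/-- The natural map `G / Γ_{n+1} → G / Γ_n`. -/
def SubgroupChain.proj (c : SubgroupChain G) (n : ℕ) : G ⧸ c.Γ (n + 1) →+ G ⧸ c.Γ n :=
  QuotientAddGroup.map (c.Γ (n + 1)) (c.Γ n) (AddMonoidHom.id G) (c.anti n)

/-- The `G`-odometer associated to a decreasing sequence of finite index subgroups: the inverse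
limit of the quotients `G / Γ_n`. -/
def Odometer (c : SubgroupChain G) : Type _ :=
  {y : ∀ n, G ⧸ c.Γ n // ∀ n, c.proj n (y (n + 1)) = y n}

/-- The product topology, each `G / Γ_n` being discrete. -/
instance Odometer.topologicalSpace (c : SubgroupChain G) : TopologicalSpace (Odometer c) :=
  letI : ∀ n, TopologicalSpace (G ⧸ c.Γ n) := fun _ => ⊥
  instTopologicalSpaceSubtype

instance Odometer.t2Space (c : SubgroupChain G) : T2Space (Odometer c) := by
  let : ∀ n, TopologicalSpace (G ⧸ c.Γ n) := fun _ => ⊥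
  have : ∀ n, DiscreteTopology (G ⧸ c.Γ n) := fun _ => ⟨rfl⟩
  exact inferInstanceAs
    (T2Space {y : ∀ n, G ⧸ c.Γ n // ∀ n, c.proj n (y (n + 1)) = y n})

instance Odometer.compactSpace (c : SubgroupChain G) : CompactSpace (Odometer c) := by
  let _ : ∀ n, TopologicalSpace (G ⧸ c.Γ n) := fun _ => ⊥
  haveI : ∀ n, DiscreteTopology (G ⧸ c.Γ n) := fun _ => ⟨rfl⟩
  haveI : ∀ n, Finite (G ⧸ c.Γ n) := fun n =>
    haveI := c.finiteIndex n
    AddSubgroup.finite_quotient_of_finiteIndex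
  have hcl : IsClosed {y : ∀ n, G ⧸ c.Γ n | ∀ n, c.proj n (y (n + 1)) = y n} := by
    simp only [Set.ofPred_forall]
    exact isClosed_iInter fun n => isClosed_eq
      (continuous_of_discreteTopology.comp (continuous_apply (n + 1))) (continuous_apply n)
  exact isCompact_iff_compactSpace.mp hcl.isCompact

/-- `G` acts on the odometer by coordinatewise translation. -/
instance Odometer.addAction (c : SubgroupChain G) : AddAction G (Odometer c) where
  vadd g y := ⟨fun n => (g : G ⧸ c.Γ n) + y.1 n, fun n => by
    rw [map_add, y.2 n]; rfl⟩
  zero_vadd y := Subtype.ext (funext fun n => zero_add (y.1 n))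
  add_vadd g h y := Subtype.ext (funext fun n => add_assoc (g : G ⧸ c.Γ n) (h : G ⧸ c.Γ n) (y.1 n))

instance Odometer.continuousConstVAdd (c : SubgroupChain G) :
    ContinuousConstVAdd G (Odometer c) where
  continuous_const_vadd g := by
    letI : ∀ n, TopologicalSpace (G ⧸ c.Γ n) := fun _ => ⊥
    haveI : ∀ n, DiscreteTopology (G ⧸ c.Γ n) := fun _ => ⟨rfl⟩
    refine Continuous.subtype_mk (continuous_pi fun n => ?_) _
    exact (continuous_of_discreteTopology (f := fun z : G ⧸ c.Γ n => (g : G ⧸ c.Γ n) + z)).comp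
      ((continuous_apply n).comp continuous_subtype_val)

/-- The odometer of `c` is universal: every `G`-odometer is a factor of it. -/
def IsUniversalOdometer (c : SubgroupChain G) : Prop :=
  ∀ c' : SubgroupChain G, ∃ f : Odometer c → Odometer c', IsFactorMap G f

end Odometers

/-! Fix rapidly growing sides `m_0 = 1`, `m_{n+1} = m_n N_n`. An array is built from a hierarchy of
symbols: a symbol of level `n + 1` stands for a cube of side `m_{n+1}` filled with `N_n ^ d` symbols
of level `n`. Each requirement on these arrangements yields one property of the array.

Toeplitz: every arrangement carries symbol `0` at position `0`, so the content of the central cube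
of level `n` recurs with period `m_{n+1}`, and the central cubes exhaust `ℤ^d`. The same recurrence
gives minimality.

Unique ergodicity: in every arrangement every symbol occurs equally often, so all cubes of level `n
+ 1` have nearly the same statistics for patterns that are small compared with `m_n`
(`exists_uniform_average`).

Odometer: the multiples of `N_n` are the only positions at which all arrangements agree, so a finite
window reveals the phase modulo `m_n` (`exists_window`). This defines a factor map onto the odometer
of the groups `m_n ℤ^d`. A point of phase `0` modulo `m_{n+1}` agrees with the array on the central
cube of level `n`; hence points in one fibre can be brought close together by a common translation,
and no equicontinuous factor separates them. If `n + 1` divides `N_n`, every finite index subgroup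
contains some `m_n ℤ^d`, so the odometer is universal.

Entropy: level `n` has `⌊exp (h m_n ^ d)⌋ + 1` symbols. For the upper bound, a pattern on `F` is
determined by a phase and by the symbols of the cubes that `F` meets. For the lower bound, Shearer's
inequality transfers the count on large cubes to every finite `F` (`mul_card_le_log`).

Such towers exist for `0 < h < log k`, and `λ(k) ≤ λ_0(k) = log k`. With `q` symbols on level `n`
and `L = N_n ^ d` places, there are at least `q ^ L` divided by a polynomial in `L` balanced
arrangements (`pow_le_card_balancedArrangements`). Since `q > exp (h m_n ^ d)`, this exceeds the
number `⌊exp (h m_n ^ d L)⌋ + 1` required on the next level once `L` is large (`exists_side`). -/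

/-! ## Block towers -/

/-- Combinatorial data for a Toeplitz array on `ℤ^d`: at level `n` there are `Q n + 1` symbols, and
every symbol of level `n + 1` is an arrangement of symbols of level `n` on a cube of side `N n`. -/
structure BlockTower (d k : ℕ) where
  N : ℕ → ℕ
  three_le : ∀ n, 3 ≤ N n
  Q : ℕ → ℕ
  ι : Fin (Q 0 + 1) → Fin k
  ι_injective : Function.Injective ι
  τ : ∀ n, Fin (Q (n + 1) + 1) → (Fin d → ℤ) → Fin (Q n + 1)
  τ_periodic : ∀ n a t v, τ n a (t + (N n : ℤ) • v) = τ n a t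
  τ_zero : ∀ n a, τ n a 0 = 0
  r : ℕ → ℕ
  r_pos : ∀ n, 0 < r n
  -- The box begins at `-1`, so with sides at least `3` the position `0` is interior to it. This is
  -- what lets the central cubes grow in all directions.
  balanced : ∀ n a b, ((Fintype.piFinset fun _ : Fin d => Finset.Ico (-1 : ℤ) (N n - 1)).filter
    fun t => τ n a t = b).card = r n
  τ_injective : ∀ n a a', a ≠ a' →
    ∃ t ∈ Fintype.piFinset fun _ : Fin d => Finset.Ico (-1 : ℤ) (N n - 1), τ n a t ≠ τ n a' t
  τ_free : ∀ n t, (∀ a a', τ n a t = τ n a' t) → ∃ v : Fin d → ℤ, t = (N n : ℤ) • v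

lemma ediv_eq_zero_iff_of_pos {z N : ℤ} (hN : 0 < N) : z / N = 0 ↔ 0 ≤ z ∧ z < N := by
  refine ⟨fun h => ?_, fun h => Int.ediv_eq_zero_of_lt h.1 h.2⟩
  have h1 := Int.emod_add_mul_ediv z N
  have h2 := Int.emod_nonneg z hN.ne'
  have h3 := Int.emod_lt_of_pos z hN
  rw [h, mul_zero, add_zero] at h1
  omega

/-! ### Geometry of the nested cubes -/

namespace BlockTower

variable {d k : ℕ} (B : BlockTower d k)

/-- The side of the cubes of level `n`. -/
def m (n : ℕ) : ℕ := ∏ i ∈ Finset.range n, B.N i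

/-- The lower corner of the central cube of level `n`. -/
def corner : ℕ → ℤ
  | 0 => 0
  | n + 1 => corner n - B.m n

/-- The index of the cube of level `n` that contains `g`. -/
def tile (n : ℕ) (g : Fin d → ℤ) : Fin d → ℤ := fun i => (g i - B.corner n) / (B.m n : ℤ)

/-- The index of the cube of level `n + 1` that contains the cube of level `n` with index `t`. -/
def parent (n : ℕ) (t : Fin d → ℤ) : Fin d → ℤ := fun i => (t i + 1) / (B.N n : ℤ)

/-- The central cube of level `n`. -/
noncomputable def cube (n : ℕ) : Finset (Fin d → ℤ) :=
  Fintype.piFinset fun _ => Finset.Ico (B.corner n) (B.corner n + B.m n)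

lemma N_pos (n : ℕ) : (0 : ℤ) < B.N n := by have := B.three_le n; omega

lemma m_zero : B.m 0 = 1 := rfl

lemma m_succ (n : ℕ) : B.m (n + 1) = B.m n * B.N n := Finset.prod_range_succ _ _

lemma m_pos_nat (n : ℕ) : 0 < B.m n :=
  Finset.prod_pos fun i _ => by have := B.three_le i; omega

lemma m_pos (n : ℕ) : (0 : ℤ) < B.m n := by exact_mod_cast B.m_pos_nat n

lemma tile_zero (g : Fin d → ℤ) : B.tile 0 g = g := by
  ext i; simp [tile, corner, m_zero]

lemma tile_succ (n : ℕ) (g : Fin d → ℤ) : B.tile (n + 1) g = B.parent n (B.tile n g) := by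
  ext i
  have hm := B.m_pos n
  simp only [tile, parent, corner, m_succ, Nat.cast_mul]
  rw [← Int.ediv_ediv_of_nonneg hm.le]
  congr 1
  rw [show g i - (B.corner n - (B.m n : ℤ)) = (g i - B.corner n) + 1 * (B.m n : ℤ) by ring,
    Int.add_mul_ediv_right _ _ hm.ne']

lemma tile_add (n : ℕ) (g v : Fin d → ℤ) :
    B.tile n (g + (B.m n : ℤ) • v) = B.tile n g + v := by
  ext i
  simp only [tile, Pi.add_apply, Pi.smul_apply, smul_eq_mul]
  rw [show g i + (B.m n : ℤ) * v i - B.corner n = (g i - B.corner n) + v i * (B.m n : ℤ) by ring,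
    Int.add_mul_ediv_right _ _ (B.m_pos n).ne']

lemma parent_add (n : ℕ) (t v : Fin d → ℤ) :
    B.parent n (t + (B.N n : ℤ) • v) = B.parent n t + v := by
  ext i
  simp only [parent, Pi.add_apply, Pi.smul_apply, smul_eq_mul]
  rw [show t i + (B.N n : ℤ) * v i + 1 = (t i + 1) + v i * (B.N n : ℤ) by ring,
    Int.add_mul_ediv_right _ _ (B.N_pos n).ne']

lemma parent_zero (n : ℕ) : B.parent n (0 : Fin d → ℤ) = 0 := by
  ext i
  have := B.three_le n
  simp only [parent, Pi.zero_apply, zero_add]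
  exact Int.ediv_eq_zero_of_lt (by norm_num) (by omega)

lemma mem_box_iff {n : ℕ} {t : Fin d → ℤ} :
    (t ∈ Fintype.piFinset fun _ : Fin d => Finset.Ico (-1 : ℤ) (B.N n - 1)) ↔
      B.parent n t = 0 := by
  have hN := B.N_pos n
  simp only [Fintype.mem_piFinset, Finset.mem_Ico, funext_iff, parent, Pi.zero_apply]
  refine forall_congr' fun i => ?_
  rw [ediv_eq_zero_iff_of_pos hN]
  constructor <;> intro h <;> omega

lemma mem_cube {n : ℕ} {g : Fin d → ℤ} : g ∈ B.cube n ↔ B.tile n g = 0 := by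
  have hN := B.m_pos n
  simp only [cube, Fintype.mem_piFinset, Finset.mem_Ico, funext_iff, tile, Pi.zero_apply]
  refine forall_congr' fun i => ?_
  rw [ediv_eq_zero_iff_of_pos hN]
  constructor <;> intro h <;> omega

lemma card_cube (n : ℕ) : (B.cube n).card = B.m n ^ d := by
  simp [cube, Fintype.card_piFinset]

lemma corner_le (n : ℕ) : B.corner n ≤ -n ∧ (n : ℤ) + 1 ≤ B.corner n + B.m n := by
  induction n with
  | zero => simp [corner, m_zero]
  | succ n ih =>
    have h3 : (3 : ℤ) ≤ B.N n := by exact_mod_cast B.three_le n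
    have hm := B.m_pos n
    simp only [corner, m_succ, Nat.cast_mul, Nat.cast_add, Nat.cast_one]
    constructor
    · omega
    · nlinarith

lemma exists_subset_cube (F : Finset (Fin d → ℤ)) : ∃ n₀, ∀ n ≥ n₀, F ⊆ B.cube n := by
  refine ⟨∑ g ∈ F, ∑ i, (g i).natAbs, fun n hn g hg => ?_⟩
  simp only [cube, Fintype.mem_piFinset, Finset.mem_Ico]
  intro i
  have h1 := Finset.single_le_sum (f := fun i => (g i).natAbs) (fun _ _ => Nat.zero_le _)
    (Finset.mem_univ i)
  have h2 := Finset.single_le_sum (f := fun g : Fin d → ℤ => ∑ i, (g i).natAbs)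
    (fun _ _ => Nat.zero_le _) hg
  have h3 := B.corner_le n
  omega

/-! ### The array -/

/-- The symbols of level `n` that are obtained by filling every cube of level `n + j` with `0`. -/
def approx : ∀ (_ n : ℕ), (Fin d → ℤ) → Fin (B.Q n + 1)
  | 0, _, _ => 0
  | j + 1, n, t => B.τ n (approx j (n + 1) (B.parent n t)) t

/-- The array of symbols of level `n`. -/
def symbol (n : ℕ) (t : Fin d → ℤ) : Fin (B.Q n + 1) := B.approx (∑ i, (t i).natAbs) n t

/-- The periodic array that consists of the blocks of the symbol `a` of level `n`. -/
def eval : ∀ n, Fin (B.Q n + 1) → (Fin d → ℤ) → Fin k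
  | 0, a, _ => B.ι a
  | n + 1, a, g => eval n (B.τ n a (B.tile n g)) g

/-- The Toeplitz array of a block tower. -/
def array (g : Fin d → ℤ) : Fin k := B.ι (B.symbol 0 g)

/-- Passing to the parent moves every nonzero coordinate strictly towards `0`, so after finitely
many levels each index reaches the origin, where the symbol is prescribed. -/
lemma natAbs_parent (n : ℕ) (t : Fin d → ℤ) (i : Fin d) :
    (B.parent n t i).natAbs ≤ (t i).natAbs - 1 := by
  have h3 : (3 : ℤ) ≤ B.N n := by exact_mod_cast B.three_le n
  have h1 := Int.ediv_mul_le (t i + 1) (B.N_pos n).ne'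
  have h2 := Int.lt_ediv_add_one_mul_self (t i + 1) (B.N_pos n)
  change ((t i + 1) / (B.N n : ℤ)).natAbs ≤ _
  generalize (t i + 1) / (B.N n : ℤ) = z at *
  generalize t i = s at *
  generalize (B.N n : ℤ) = M at *
  rcases lt_trichotomy z 0 with hz | rfl | hz
  · have : (z + 1) * M ≤ (z + 1) * 3 := by nlinarith
    omega
  · simp
  · have : z * 3 ≤ z * M := by nlinarith
    omega

lemma sum_natAbs_parent (n : ℕ) (t : Fin d → ℤ) :
    ∑ i, (B.parent n t i).natAbs ≤ (∑ i, (t i).natAbs) - 1 := by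
  rcases Nat.eq_zero_or_pos (∑ i, (t i).natAbs) with h0 | hpos
  · have h : ∀ i, (t i).natAbs = 0 := by simpa using h0
    rw [h0]
    refine le_of_eq (Finset.sum_eq_zero fun i _ => ?_)
    have := B.natAbs_parent n t i
    have := h i
    omega
  · refine Nat.le_sub_one_of_lt (Finset.sum_lt_sum (fun i _ => ?_) ?_)
    · have := B.natAbs_parent n t i
      omega
    · obtain ⟨i, hi, hi'⟩ := Finset.exists_ne_zero_of_sum_ne_zero hpos.ne'
      have := B.natAbs_parent n t i
      exact ⟨i, hi, by omega⟩

lemma eq_zero_of_sum_natAbs {t : Fin d → ℤ} (h : ∑ i, (t i).natAbs = 0) : t = 0 := by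
  ext i
  have h' : ∀ i, (t i).natAbs = 0 := by simpa using h
  simpa using h' i

lemma approx_zero (j n : ℕ) : B.approx j n 0 = 0 := by
  cases j with
  | zero => rfl
  | succ j => exact B.τ_zero _ _

/-- After `j` steps up the hierarchy the index has become `0`. There the symbol is `0` in any case,
so the arbitrary filling above that level has no effect. -/
lemma approx_eq (j : ℕ) : ∀ (n : ℕ) (t : Fin d → ℤ), ∑ i, (t i).natAbs ≤ j →
    ∀ j' ≥ j, B.approx j' n t = B.approx j n t := by
  induction j with
  | zero =>
    intro n t ht j' _
    rw [eq_zero_of_sum_natAbs (Nat.le_zero.1 ht), approx_zero, approx_zero]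
  | succ j ih =>
    intro n t ht j' hj'
    obtain ⟨j', rfl⟩ : ∃ i, j' = i + 1 := ⟨j' - 1, by omega⟩
    simp only [approx]
    rw [ih (n + 1) (B.parent n t) (by have := B.sum_natAbs_parent n t; omega) j' (by omega)]

lemma symbol_zero (n : ℕ) : B.symbol n 0 = 0 := B.approx_zero _ _

lemma symbol_eq (n : ℕ) (t : Fin d → ℤ) :
    B.symbol n t = B.τ n (B.symbol (n + 1) (B.parent n t)) t := by
  rcases Nat.eq_zero_or_pos (∑ i, (t i).natAbs) with h0 | hpos
  · rw [eq_zero_of_sum_natAbs h0, symbol_zero, τ_zero]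
  · obtain ⟨s, hs⟩ : ∃ s, ∑ i, (t i).natAbs = s + 1 := ⟨_, (Nat.sub_add_cancel hpos).symm⟩
    have h1 : B.symbol n t = B.τ n (B.approx s (n + 1) (B.parent n t)) t := by
      rw [symbol, hs]; rfl
    rw [h1, symbol, B.approx_eq _ (n + 1) (B.parent n t) le_rfl s
      (by have := B.sum_natAbs_parent n t; omega)]

lemma symbol_smul (n : ℕ) (v : Fin d → ℤ) : B.symbol n ((B.N n : ℤ) • v) = 0 := by
  rw [symbol_eq, ← zero_add ((B.N n : ℤ) • v), τ_periodic, τ_zero]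

lemma array_eq (n : ℕ) (g : Fin d → ℤ) :
    B.array g = B.eval n (B.symbol n (B.tile n g)) g := by
  induction n with
  | zero => rw [tile_zero]; rfl
  | succ n ih => rw [ih, eval, symbol_eq, tile_succ]

lemma eval_periodic (n : ℕ) : ∀ (a : Fin (B.Q n + 1)) (g v : Fin d → ℤ),
    B.eval n a (g + (B.m n : ℤ) • v) = B.eval n a g := by
  induction n with
  | zero => intros; rfl
  | succ n ih =>
    intro a g v
    have h : (B.m (n + 1) : ℤ) • v = (B.m n : ℤ) • ((B.N n : ℤ) • v) := by
      rw [m_succ, smul_smul, Nat.cast_mul]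
    simp only [eval, h, tile_add, τ_periodic, ih]

lemma eval_injective (n : ℕ) : ∀ a a' : Fin (B.Q n + 1), a ≠ a' →
    ∃ u, B.tile n u = 0 ∧ B.eval n a u ≠ B.eval n a' u := by
  induction n with
  | zero => exact fun a a' h => ⟨0, B.tile_zero 0, fun h' => h (B.ι_injective h')⟩
  | succ n ih =>
    intro a a' h
    obtain ⟨t, ht, hne⟩ := B.τ_injective n a a' h
    obtain ⟨u, hu, hne'⟩ := ih _ _ hne
    have htile : B.tile n (u + (B.m n : ℤ) • t) = t := by rw [tile_add, hu, zero_add]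
    refine ⟨u + (B.m n : ℤ) • t, ?_, ?_⟩
    · rw [tile_succ, htile, ← mem_box_iff]
      exact ht
    · simpa only [eval, htile, eval_periodic] using hne'

/-- The translate lies in the level `n` cube of index `N_n v`, and every arrangement carries `0`
there, just as at index `0`. -/
lemma array_add_smul {n : ℕ} {g : Fin d → ℤ} (hg : B.tile n g = 0) (v : Fin d → ℤ) :
    B.array (g + (B.m (n + 1) : ℤ) • v) = B.array g := by
  have h : (B.m (n + 1) : ℤ) • v = (B.m n : ℤ) • ((B.N n : ℤ) • v) := by
    rw [m_succ, smul_smul, Nat.cast_mul]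
  rw [B.array_eq n, B.array_eq n g, h, tile_add, hg, zero_add, symbol_smul, symbol_zero,
    eval_periodic]

lemma exists_symbol_eq (n : ℕ) (v : Fin d → ℤ) (b : Fin (B.Q n + 1)) :
    ∃ t, B.parent n t = v ∧ B.symbol n t = b := by
  have h := B.balanced n (B.symbol (n + 1) v) b
  obtain ⟨t, ht⟩ := Finset.card_pos.1 (h ▸ B.r_pos n)
  rw [Finset.mem_filter, mem_box_iff] at ht
  refine ⟨t + (B.N n : ℤ) • v, by rw [parent_add, ht.1, zero_add], ?_⟩
  rw [symbol_eq, parent_add, ht.1, zero_add, τ_periodic, ht.2]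

/-! ### Periods of the array and recognition of the phase -/

/-- The subgroup `m_n ℤ^d`. -/
def lattice (n : ℕ) : AddSubgroup (Fin d → ℤ) :=
  (zsmulAddGroupHom (B.m n : ℤ)).range

lemma lattice_anti (n : ℕ) : B.lattice (n + 1) ≤ B.lattice n := by
  rintro _ ⟨v, rfl⟩
  exact ⟨(B.N n : ℤ) • v, by simp [m_succ, mul_assoc]⟩

lemma lattice_finiteIndex (n : ℕ) : (B.lattice n).FiniteIndex := by
  have : Finite ((Fin d → ℤ) ⧸ B.lattice n) := by
    refine Finite.of_surjective (fun u : B.cube n => ((u : Fin d → ℤ) : (Fin d → ℤ) ⧸ B.lattice n))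
      fun y => ?_
    induction y using QuotientAddGroup.induction_on with
    | H g =>
      refine ⟨⟨g + (B.m n : ℤ) • (-B.tile n g), ?_⟩, ?_⟩
      · rw [mem_cube, tile_add, add_neg_cancel]
      · rw [QuotientAddGroup.eq]
        exact ⟨B.tile n g, by simp⟩
  exact AddSubgroup.finiteIndex_of_finite_quotient

theorem array_isToeplitz : IsToeplitzArray B.array := by
  intro g
  obtain ⟨n, hn⟩ := B.exists_subset_cube {g}
  refine ⟨B.lattice (n + 1), B.lattice_finiteIndex _, ?_⟩
  rintro _ ⟨v, rfl⟩
  exact B.array_add_smul (B.mem_cube.1 (hn n le_rfl (by simp))) v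

lemma sub_mem_sub_cube {n : ℕ} {g g' : Fin d → ℤ} (h : B.tile n g = B.tile n g') :
    ∃ u ∈ B.cube n, ∃ u' ∈ B.cube n, u - u' = g - g' := by
  refine ⟨g + (B.m n : ℤ) • (-B.tile n g), ?_, g' + (B.m n : ℤ) • (-B.tile n g'), ?_, ?_⟩
  · rw [mem_cube, tile_add, add_neg_cancel]
  · rw [mem_cube, tile_add, add_neg_cancel]
  · rw [h]; abel

open scoped Classical Pointwise in
/-- The phase of `g` modulo `m_n` can be read off a finite window of the array around `g`. -/
theorem exists_window (n : ℕ) : ∃ W : Finset (Fin d → ℤ), ∀ g g',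
    (∀ w ∈ W, B.array (g + w) = B.array (g' + w)) → g' - g ∈ B.lattice n := by
  induction n with
  | zero => exact ⟨∅, fun g g' _ => ⟨g' - g, by simp [m_zero]⟩⟩
  | succ n ih =>
    obtain ⟨W, hW⟩ := ih
    refine ⟨W ∪ (B.cube (n + 2) - B.cube (n + 2)), fun g g' h => ?_⟩
    obtain ⟨v₀, hv₀⟩ := hW g g' fun w hw => h w (Finset.mem_union_left _ hw)
    have hv₀' : (B.m n : ℤ) • v₀ = g' - g := hv₀
    -- The two views are out of step by `m_n v₀`. Inside the level `n + 2` cube around `g'` there is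
    -- a level `n + 1` cube with symbol `a`. Its position congruent to `v₀` modulo `N_n` is seen
    -- from `g` at a multiple of `N_n`, where the symbol is `0`; a different symbol would show
    -- within the window.
    have key : ∀ a, B.τ n a v₀ = 0 := by
      intro a
      obtain ⟨t, ht, hta⟩ := B.exists_symbol_eq (n + 1) (B.tile (n + 2) g') a
      set c : Fin d → ℤ := v₀ + (B.N n : ℤ) • (t - B.parent n v₀) with hc
      have hpc : B.parent n c = t := by rw [hc, parent_add]; abel
      have hsym : B.symbol n c = B.τ n a v₀ := by
        rw [symbol_eq, hpc, hta, hc, τ_periodic]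
      by_contra hne
      obtain ⟨w, hw, hwne⟩ := B.eval_injective n _ _ hne
      have htile : B.tile n (w + (B.m n : ℤ) • c) = c := by rw [tile_add, hw, zero_add]
      have h2 : B.tile (n + 2) (w + (B.m n : ℤ) • c) = B.tile (n + 2) g' := by
        rw [tile_succ, tile_succ, htile, hpc, ht]
      obtain ⟨u, hu, u', hu', huu⟩ := B.sub_mem_sub_cube h2
      have h3 := h _ (Finset.mem_union_right _ (Finset.sub_mem_sub hu hu'))
      rw [huu] at h3
      have e1 : g' + (w + (B.m n : ℤ) • c - g') = w + (B.m n : ℤ) • c := by abel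
      have e2 : g + (w + (B.m n : ℤ) • c - g') =
          w + (B.m n : ℤ) • ((B.N n : ℤ) • (t - B.parent n v₀)) := by
        rw [hc, smul_add, hv₀']; abel
      rw [e1, e2, B.array_eq n, B.array_eq n (w + (B.m n : ℤ) • c), htile, tile_add, hw, zero_add,
        symbol_smul, hsym, eval_periodic, eval_periodic] at h3
      exact hwne h3.symm
    obtain ⟨v, hv⟩ := B.τ_free n v₀ fun a a' => by rw [key a, key a']
    exact ⟨v, by rw [← hv₀', hv, smul_smul, m_succ]; simp⟩

end BlockTower

/-! ## Orbit closures -/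

section OrbitClosure

open SymbolicDynamics.FullShift

variable {G A : Type*} [AddCommGroup G] [TopologicalSpace A] [DiscreteTopology A]

lemma exists_shift_eq_of_mem_orbitClosure {x y : G → A} (hy : y ∈ (orbitClosure x).carrier)
    (M : Finset G) : ∃ g, ∀ w ∈ M, y w = x (g + w) := by
  obtain ⟨_, hz, g, rfl⟩ := mem_closure_iff.1 hy _ (isOpen_cylinder M y) fun _ _ => rfl
  exact ⟨g, fun w hw => (hz w hw).symm⟩

lemma shift_mem_orbitClosure {A : Type*} [TopologicalSpace A] (x : G → A) (g : G) :
    shift g x ∈ (orbitClosure x).carrier :=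
  subset_closure ⟨g, rfl⟩

lemma self_mem_orbitClosure {A : Type*} [TopologicalSpace A] (x : G → A) :
    x ∈ (orbitClosure x).carrier := by
  simpa using shift_mem_orbitClosure x 0

lemma exists_finset_forall_eq_mem {A : Type*} [TopologicalSpace A] {X : Subshift A G}
    {U : Set X.carrier} (hU : IsOpen U)
    {z : X.carrier} (hz : z ∈ U) :
    ∃ M : Finset G, ∀ y : X.carrier, (∀ w ∈ M, y.1 w = z.1 w) → y ∈ U := by
  obtain ⟨O, hO, rfl⟩ := isOpen_induced_iff.1 hU
  obtain ⟨M, u, hu, hM⟩ := isOpen_pi_iff.1 hO z.1 hz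
  exact ⟨M, fun y hy => hM fun w hw => by rw [hy w hw]; exact (hu w hw).2⟩

lemma isOpen_setOf_forall_eq (X : Subshift A G) (M : Finset G) (z : G → A) :
    IsOpen {y : X.carrier | ∀ w ∈ M, y.1 w = z w} :=
  (isOpen_cylinder M z).preimage continuous_subtype_val

lemma subshift_vadd_apply {A : Type*} [TopologicalSpace A] {X : Subshift A G} (g : G) (y : X.carrier)
    (w : G) : (g +ᵥ y).1 w = y.1 (g + w) := rfl

instance {A : Type*} [TopologicalSpace A] [CompactSpace A] (X : Subshift A G) :
    CompactSpace X.carrier :=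
  isCompact_iff_compactSpace.1 X.isClosed.isCompact

end OrbitClosure

/-! ## Odometers -/

namespace Odometer

variable {G : Type*} [AddCommGroup G] {c : SubgroupChain G}

lemma isClopen_setOf_eq (n : ℕ) (a : G ⧸ c.Γ n) : IsClopen {y : Odometer c | y.1 n = a} := by
  let : ∀ n, TopologicalSpace (G ⧸ c.Γ n) := fun _ => ⊥
  have : ∀ n, DiscreteTopology (G ⧸ c.Γ n) := fun _ => ⟨rfl⟩
  have h : Continuous fun y : Odometer c => y.1 n :=
    (continuous_apply n).comp continuous_subtype_val
  exact (isClopen_discrete {a}).preimage h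

lemma continuous_of_isOpen {X : Type*} [TopologicalSpace X] {f : X → Odometer c}
    (hf : ∀ n a, IsOpen {x | (f x).1 n = a}) : Continuous f := by
  let : ∀ n, TopologicalSpace (G ⧸ c.Γ n) := fun _ => ⊥
  have : ∀ n, DiscreteTopology (G ⧸ c.Γ n) := fun _ => ⟨rfl⟩
  have h : Continuous fun x => (f x).1 :=
    continuous_pi fun n => continuous_discrete_rng.2 fun a => hf n a
  exact Continuous.subtype_mk h fun x => (f x).2

lemma coord_vadd (g : G) (y : Odometer c) (n : ℕ) :
    (g +ᵥ y).1 n = (g : G ⧸ c.Γ n) + y.1 n := rfl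

lemma exists_rep (y : Odometer c) (n : ℕ) : ∃ g : G, ∀ i ≤ n, y.1 i = (g : G ⧸ c.Γ i) := by
  obtain ⟨g, hg⟩ := QuotientAddGroup.mk_surjective (y.1 n)
  refine ⟨g, fun i hi => ?_⟩
  induction hi using Nat.decreasingInduction with
  | self => exact hg.symm
  | of_succ i _ ih => rw [← y.2 i, ih]; rfl

lemma eq_of_le {y y' : Odometer c} {i n : ℕ} (hi : i ≤ n) (h : y.1 n = y'.1 n) :
    y.1 i = y'.1 i := by
  obtain ⟨g, hg⟩ := exists_rep y n
  obtain ⟨g', hg'⟩ := exists_rep y' n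
  rw [hg i hi, hg' i hi]
  rw [hg n le_rfl, hg' n le_rfl, QuotientAddGroup.eq] at h
  rw [QuotientAddGroup.eq]
  exact antitone_nat_of_succ_le c.anti hi h

/-- `G` acts transitively on each `G / Γ_n`, so each finite level of `y` is attained; compactness
handles all levels at once. -/
lemma surjective_of_equivariant {X : Type*} [TopologicalSpace X] [CompactSpace X] [Nonempty X]
    [AddAction G X] {f : X → Odometer c} (hf : Continuous f)
    (he : ∀ (g : G) x, f (g +ᵥ x) = g +ᵥ f x) : Function.Surjective f := by
  intro y
  have hcl : ∀ n, IsClosed {x | (f x).1 n = y.1 n} := fun n =>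
    (isClopen_setOf_eq n _).isClosed.preimage hf
  obtain ⟨x, hx⟩ := IsCompact.nonempty_iInter_of_sequence_nonempty_isCompact_isClosed
    (fun n => {x | (f x).1 n = y.1 n}) (fun n x hx => eq_of_le n.le_succ hx)
    (fun n => by
      obtain ⟨x₀⟩ := ‹Nonempty X›
      obtain ⟨g, hg⟩ := QuotientAddGroup.mk_surjective (y.1 n - (f x₀).1 n)
      refine ⟨g +ᵥ x₀, ?_⟩
      change (f (g +ᵥ x₀)).1 n = y.1 n
      rw [he, coord_vadd, hg, sub_add_cancel])
    (hcl 0).isCompact hcl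
  exact ⟨x, Subtype.ext (funext fun n => Set.mem_iInter.1 hx n)⟩

theorem isEquicontinuousSystem (c : SubgroupChain G) :
    IsEquicontinuousSystem G (Odometer c) := by
  unfold IsEquicontinuousSystem
  intro V hV
  have hV' : V ∈ 𝓝ˢ (Set.diagonal (Odometer c)) := hV
  obtain ⟨O, hO, hdO, hOV⟩ := mem_nhdsSet_iff_exists.1 hV'
  set E : ℕ → Set (Odometer c × Odometer c) := fun n => {p | p.1.1 n = p.2.1 n} with hE
  have hEclopen : ∀ n, IsClopen (E n) := by
    intro n
    have : E n = ⋃ a : G ⧸ c.Γ n, {p | p.1.1 n = a} ∩ {p | p.2.1 n = a} := by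
      ext p
      simp [hE, eq_comm]
    rw [this]
    have := c.finiteIndex n
    have : Finite (G ⧸ c.Γ n) := AddSubgroup.finite_quotient_of_finiteIndex
    exact isClopen_iUnion_of_finite fun a =>
      ((isClopen_setOf_eq n a).preimage continuous_fst).inter
        ((isClopen_setOf_eq n a).preimage continuous_snd)
  -- The `E n` decrease to the diagonal, so compactness puts one of them inside `O`. Each `E n` is
  -- invariant under translations, which gives equicontinuity.
  have hn : ∃ n, E n ⊆ O := by
    by_contra! hcon
    obtain ⟨p, hp⟩ := IsCompact.nonempty_iInter_of_sequence_nonempty_isCompact_isClosed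
      (fun n => E n \ O) (fun n p hp => ⟨eq_of_le n.le_succ hp.1, hp.2⟩)
      (fun n => Set.sdiff_nonempty.2 (hcon n))
      ((hEclopen 0).isClosed.sdiff hO).isCompact fun n => (hEclopen n).isClosed.sdiff hO
    have hp' := Set.mem_iInter.1 hp
    exact (hp' 0).2 (hdO (Subtype.ext (funext fun n => (hp' n).1)))
  obtain ⟨n, hn⟩ := hn
  have hmem : E n ∈ 𝓝ˢ (Set.diagonal (Odometer c)) :=
    (hEclopen n).isOpen.mem_nhdsSet.2 fun p hp => by
      rw [Set.mem_diagonal_iff] at hp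
      exact congrArg (fun y : Odometer c => y.1 n) hp
  refine Filter.mem_of_superset (x := E n) hmem fun p hp g => hOV (hn ?_)
  change (g +ᵥ p.1).1 n = (g +ᵥ p.2).1 n
  have hp' : p.1.1 n = p.2.1 n := hp
  rw [coord_vadd, coord_vadd, hp']

end Odometer

/-- A point-separation criterion for maximal equicontinuous factors: any two points in the same
fibre of `π` can be moved into any given neighbourhood of a base point simultaneously. -/
theorem IsFactorMap.isMaximalEquicontinuousFactor {G : Type} [AddCommGroup G] {X Y : Type}
    [TopologicalSpace X] [CompactSpace X] [AddAction G X]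
    [TopologicalSpace Y] [CompactSpace Y] [T2Space Y] [AddAction G Y] {π : X → Y}
    (hπ : IsFactorMap G π) (hY : IsEquicontinuousSystem G Y) (x : X)
    (hprox : ∀ U ∈ 𝓝 x, ∀ y y', π y = π y' → ∃ g : G, g +ᵥ y ∈ U ∧ g +ᵥ y' ∈ U) :
    IsMaximalEquicontinuousFactor G π where
  isFactorMap := hπ
  equicontinuous := hY
  maximal := by
    intro Z _ _ _ _ _ hZ f hf
    have hfib : ∀ y y', π y = π y' → f y = f y' := by
      intro y y' hyy
      let : UniformSpace Z := uniformSpaceOfCompactR1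
      have hZ' : UniformEquicontinuous (fun (g : G) (x : Z) => g +ᵥ x) := hZ
      refine eq_of_uniformity fun {V} hV => ?_
      -- Pairs in `W` stay in `V` under all translations. The points are moved together into `W` by
      -- `g` and then returned by `-g`, so their images are `V`-close for every `V`.
      have hW := hZ' V hV
      obtain ⟨W, hW, hWV⟩ := Filter.eventually_iff_exists_mem.1 hW
      obtain ⟨W', hW', hsymm, hcomp⟩ := comp_symm_mem_uniformity_sets hW
      have hU : f ⁻¹' {z | (f x, z) ∈ W'} ∈ 𝓝 x :=
        hf.continuous.continuousAt (mem_nhds_left (f x) hW')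
      obtain ⟨g, hg, hg'⟩ := hprox _ hU y y' hyy
      have h1 : (f (g +ᵥ y), f (g +ᵥ y')) ∈ W :=
        hcomp ⟨f x, hsymm.symm _ _ hg, hg'⟩
      have h2 := hWV _ h1 (-g)
      simpa only [hf.equivariant, neg_vadd_vadd] using h2
    have hcomp : (f ∘ Function.surjInv hπ.surjective) ∘ π = f :=
      funext fun y => hfib _ _ (Function.surjInv_eq hπ.surjective (π y))
    refine ⟨f ∘ Function.surjInv hπ.surjective, ⟨?_, ?_, ?_⟩, hcomp.symm⟩
    · have hq : IsQuotientMap π :=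
        hπ.continuous.isClosedMap.isQuotientMap hπ.continuous hπ.surjective
      rw [hq.continuous_iff, hcomp]
      exact hf.continuous
    · exact Function.Surjective.of_comp (g := π) (by rw [hcomp]; exact hf.surjective)
    · intro g y
      have h1 := congrFun hcomp (g +ᵥ Function.surjInv hπ.surjective y)
      rw [Function.comp_apply, hπ.equivariant, Function.surjInv_eq hπ.surjective] at h1
      rw [h1, hf.equivariant]
      rfl

/-! ### Minimality and the maximal equicontinuous factor -/

namespace BlockTower

variable {d k : ℕ} (B : BlockTower d k)

/-- The orbit closure of the array. -/
abbrev shiftSpace : Type := (orbitClosure B.array).carrier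

/-- The array as a point of its orbit closure. -/
def base : B.shiftSpace := ⟨B.array, self_mem_orbitClosure _⟩

instance : Nonempty B.shiftSpace := ⟨B.base⟩

/-- Every cube of level `n + 1` contains a copy of the central cube of level `n`, at the same
relative place. Any point shows such a cube in a bounded window, hence also every pattern of the
array that fits into the central cube. -/
theorem isMinimal : AddAction.IsMinimal (Fin d → ℤ) B.shiftSpace := by
  classical
  open scoped Pointwise in
  refine ⟨fun y => dense_iff_inter_open.2 ?_⟩
  rintro U hU ⟨z, hz⟩
  obtain ⟨M, hM⟩ := exists_finset_forall_eq_mem hU hz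
  obtain ⟨g, hg⟩ := exists_shift_eq_of_mem_orbitClosure z.2 M
  obtain ⟨n, hn⟩ := B.exists_subset_cube (M.image (g + ·))
  obtain ⟨g', hg'⟩ := exists_shift_eq_of_mem_orbitClosure y.2
    ((B.cube (n + 1)) - (B.cube (n + 1)))
  set s := (B.m (n + 1) : ℤ) • B.tile (n + 1) g' with hs
  refine ⟨(s - g' + g) +ᵥ y, hM _ fun w hw => ?_, ⟨_, rfl⟩⟩
  have hgw : B.tile n (g + w) = 0 := B.mem_cube.1 (hn n le_rfl (Finset.mem_image_of_mem _ hw))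
  have h1 : B.tile (n + 1) (g + w + s) = B.tile (n + 1) g' := by
    rw [hs, tile_add, tile_succ, hgw, parent_zero, zero_add]
  obtain ⟨u, hu, u', hu', huu⟩ := B.sub_mem_sub_cube h1
  have h2 := hg' _ (Finset.sub_mem_sub hu hu')
  rw [subshift_vadd_apply, hg w hw, ← B.array_add_smul hgw (B.tile (n + 1) g'), ← hs,
    show s - g' + g + w = u - u' by rw [huu]; abel, h2, huu]
  congr 1
  abel

/-- The subgroups `m_n ℤ^d`. -/
abbrev chain : SubgroupChain (Fin d → ℤ) where
  Γ := B.lattice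
  anti := B.lattice_anti
  finiteIndex := B.lattice_finiteIndex

/-- A window that determines the phase modulo `m_n`. -/
noncomputable def window (n : ℕ) : Finset (Fin d → ℤ) := (B.exists_window n).choose

/-- The phase of a point of the shift space modulo `m_n`. -/
noncomputable def phase (n : ℕ) (y : B.shiftSpace) : (Fin d → ℤ) ⧸ B.lattice n :=
  ((exists_shift_eq_of_mem_orbitClosure y.2 (B.window n)).choose : Fin d → ℤ)

/-- The chosen representative is immaterial: two translates that agree on the window differ by an
element of the lattice. -/
lemma phase_eq {n : ℕ} {y : B.shiftSpace} {g : Fin d → ℤ}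
    (h : ∀ w ∈ B.window n, y.1 w = B.array (g + w)) : B.phase n y = g := by
  rw [phase, QuotientAddGroup.eq, neg_add_eq_sub]
  refine (B.exists_window n).choose_spec _ _ fun w hw => ?_
  rw [← h w hw]
  exact ((exists_shift_eq_of_mem_orbitClosure y.2 (B.window n)).choose_spec w hw).symm

lemma phase_vadd (n : ℕ) (g : Fin d → ℤ) (y : B.shiftSpace) :
    B.phase n (g +ᵥ y) = (g : (Fin d → ℤ) ⧸ B.lattice n) + B.phase n y := by
  classical
  obtain ⟨g', hg'⟩ := exists_shift_eq_of_mem_orbitClosure y.2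
    (B.window n ∪ (B.window n).image (g + ·))
  rw [B.phase_eq (n := n) (y := y) (g := g') fun w hw => hg' w (Finset.mem_union_left _ hw),
    B.phase_eq (n := n) (y := g +ᵥ y) (g := g + g')]
  · rfl
  · intro w hw
    rw [subshift_vadd_apply, hg' _ (Finset.mem_union_right _ (Finset.mem_image_of_mem _ hw))]
    congr 1
    abel

lemma isOpen_phase (n : ℕ) (a : (Fin d → ℤ) ⧸ B.lattice n) :
    IsOpen {y : B.shiftSpace | B.phase n y = a} := by
  rw [isOpen_iff_mem_nhds]
  rintro y rfl
  refine Filter.mem_of_superset ((isOpen_setOf_forall_eq _ (B.window n) y.1).mem_nhds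
    (fun _ _ => rfl)) fun z hz => ?_
  obtain ⟨g, hg⟩ := exists_shift_eq_of_mem_orbitClosure y.2 (B.window n)
  change B.phase n z = B.phase n y
  rw [B.phase_eq hg, B.phase_eq (g := g) fun w hw => (hz w hw).trans (hg w hw)]

/-- The factor map onto the odometer of the tower. -/
noncomputable def toOdometer (y : B.shiftSpace) : Odometer B.chain :=
  ⟨fun n => B.phase n y, fun n => by
    classical
    obtain ⟨g, hg⟩ := exists_shift_eq_of_mem_orbitClosure y.2 (B.window n ∪ B.window (n + 1))
    have h0 := B.phase_eq (n := n) (g := g) fun w hw => hg w (Finset.mem_union_left _ hw)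
    have h1 := B.phase_eq (n := n + 1) (g := g) fun w hw => hg w (Finset.mem_union_right _ hw)
    exact (congrArg (B.chain.proj n) h1).trans h0.symm⟩

theorem isFactorMap_toOdometer : IsFactorMap (Fin d → ℤ) B.toOdometer := by
  have hc : Continuous B.toOdometer := Odometer.continuous_of_isOpen fun n a => B.isOpen_phase n a
  have he : ∀ (g : Fin d → ℤ) y, B.toOdometer (g +ᵥ y) = g +ᵥ B.toOdometer y :=
    fun g y => Subtype.ext (funext fun n => B.phase_vadd n g y)
  exact ⟨hc, Odometer.surjective_of_equivariant hc he, he⟩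

lemma eq_array_of_phase_eq_zero {n : ℕ} {y : B.shiftSpace} (h : B.phase (n + 1) y = 0)
    {w : Fin d → ℤ} (hw : w ∈ B.cube n) : y.1 w = B.array w := by
  classical
  obtain ⟨g, hg⟩ := exists_shift_eq_of_mem_orbitClosure y.2 (insert w (B.window (n + 1)))
  rw [B.phase_eq (g := g) fun u hu => hg u (Finset.mem_insert_of_mem hu),
    QuotientAddGroup.eq_zero_iff] at h
  obtain ⟨v, hv⟩ := h
  have hv' : (B.m (n + 1) : ℤ) • v = g := hv
  rw [hg w (Finset.mem_insert_self _ _), ← hv', add_comm,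
    B.array_add_smul (B.mem_cube.1 hw)]

theorem isMaximalEquicontinuousFactor_toOdometer :
    IsMaximalEquicontinuousFactor (Fin d → ℤ) B.toOdometer := by
  refine B.isFactorMap_toOdometer.isMaximalEquicontinuousFactor
    (Odometer.isEquicontinuousSystem _) B.base fun U hU y y' hyy => ?_
  obtain ⟨O, hOU, hO, hbO⟩ := mem_nhds_iff.1 hU
  obtain ⟨M, hM⟩ := exists_finset_forall_eq_mem hO hbO
  obtain ⟨n, hn⟩ := B.exists_subset_cube M
  obtain ⟨g, hg⟩ := QuotientAddGroup.mk_surjective (-B.phase (n + 1) y)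
  have hphase : B.phase (n + 1) y = B.phase (n + 1) y' :=
    congrArg (fun z : Odometer B.chain => z.1 (n + 1)) hyy
  have key : ∀ z, B.phase (n + 1) z = B.phase (n + 1) y → g +ᵥ z ∈ U := fun z hz =>
    hOU (hM _ fun w hw => B.eq_array_of_phase_eq_zero
      (by rw [phase_vadd, hz, hg, neg_add_cancel]) (hn n le_rfl hw))
  exact ⟨g, key y rfl, key y' hphase.symm⟩

theorem isUniversalOdometer_chain (hN : ∀ n, n + 1 ∣ B.N n) : IsUniversalOdometer B.chain := by
  intro c
  have hle : ∀ j, ∃ n, B.lattice n ≤ c.Γ j := by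
    intro j
    have h0 := (c.finiteIndex j).index_ne_zero
    refine ⟨(c.Γ j).index, ?_⟩
    have hdvd : (c.Γ j).index ∣ B.m (c.Γ j).index := by
      obtain ⟨e, he⟩ := Nat.exists_eq_succ_of_ne_zero h0
      rw [he, Nat.succ_eq_add_one, m_succ]
      exact (hN e).mul_left _
    rintro _ ⟨v, rfl⟩
    obtain ⟨e, he⟩ := hdvd
    -- The index annihilates `G / Γ_j` and divides `m_n` for `n` equal to the index.
    have h1 := (c.Γ j).nsmul_index_mem (e • v)
    rw [smul_smul, ← he] at h1
    simpa using h1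
  choose n hn using hle
  set f : Odometer B.chain → Odometer c := fun y =>
    ⟨fun j => QuotientAddGroup.map (B.lattice (n j)) (c.Γ j) (AddMonoidHom.id _) (hn j)
      (y.1 (n j)), fun j => by
        obtain ⟨g, hg⟩ := Odometer.exists_rep y (max (n j) (n (j + 1)))
        have h0 := congrArg (QuotientAddGroup.map (B.lattice (n j)) (c.Γ j)
          (AddMonoidHom.id _) (hn j)) (hg _ (le_max_left _ _))
        have h1 := congrArg (fun z => c.proj j (QuotientAddGroup.map (B.lattice (n (j + 1)))
          (c.Γ (j + 1)) (AddMonoidHom.id _) (hn (j + 1)) z)) (hg _ (le_max_right _ _))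
        exact h1.trans h0.symm⟩ with hf
  have hc : Continuous f := by
    refine Odometer.continuous_of_isOpen fun j a => ?_
    have h : {y : Odometer B.chain | (f y).1 j = a} =
        ⋃ b ∈ {b : (Fin d → ℤ) ⧸ B.lattice (n j) | QuotientAddGroup.map (B.lattice (n j)) (c.Γ j)
          (AddMonoidHom.id _) (hn j) b = a}, {y : Odometer B.chain | y.1 (n j) = b} := by
      ext y
      simp only [Set.mem_iUnion, Set.mem_ofPred_eq, exists_prop]
      exact ⟨fun h => ⟨_, h, rfl⟩, fun ⟨b, hb, h⟩ => by subst h; exact hb⟩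
    rw [h]
    exact isOpen_biUnion fun b _ => (Odometer.isClopen_setOf_eq (c := B.chain) (n j) b).isOpen
  have he : ∀ (g : Fin d → ℤ) y, f (g +ᵥ y) = g +ᵥ f y := by
    intro g y
    refine Subtype.ext (funext fun j => ?_)
    exact map_add (QuotientAddGroup.map (B.lattice (n j)) (c.Γ j) (AddMonoidHom.id _) (hn j))
      (g : (Fin d → ℤ) ⧸ B.lattice (n j)) (y.1 (n j))
  have : Nonempty (Odometer B.chain) := ⟨B.toOdometer B.base⟩
  exact ⟨f, hc, Odometer.surjective_of_equivariant hc he, he⟩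

end BlockTower

/-! ## Unique ergodicity from uniform convergence of averages -/

theorem isUniquelyErgodic_of_averages {G X : Type*} [AddCommGroup G] [TopologicalSpace X]
    [CompactSpace X] [T2Space X] [TopologicalSpace.PseudoMetrizableSpace X] [Nonempty X]
    [AddAction G X] [ContinuousConstVAdd G X] (A : ℕ → Finset G) (hA : ∀ n, (A n).Nonempty)
    (havg : ∀ f : BoundedContinuousFunction X ℝ, ∀ ε > 0, ∃ c : ℝ, ∃ n₀, ∀ n ≥ n₀, ∀ y,
      |∑ u ∈ A n, f (u +ᵥ y) - (A n).card * c| ≤ ε * (A n).card) :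
    IsUniquelyErgodic G X := by
  let _ : MeasurableSpace X := borel X
  have : BorelSpace X := ⟨rfl⟩
  change ∃! μ : Measure X, IsProbabilityMeasure μ ∧ VAddInvariantMeasure G X μ
  have hcard : ∀ n, (0 : ℝ) < (A n).card := fun n => by exact_mod_cast (hA n).card_pos
  refine existsUnique_of_exists_of_unique ?_ ?_
  · obtain ⟨x⟩ := ‹Nonempty X›
    -- Empirical measures along the orbit of `x`; an invariant measure is obtained as their weak
    -- limit along an ultrafilter.
    set P : ℕ → Measure X := fun n =>
      ((A n).card : ENNReal)⁻¹ • ∑ u ∈ A n, Measure.dirac (u +ᵥ x) with hP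
    have hPprob : ∀ n, IsProbabilityMeasure (P n) := fun n => ⟨by
      simp only [hP, Measure.smul_apply, Measure.finsetSum_apply, measure_univ,
        Finset.sum_const, nsmul_eq_mul, mul_one, smul_eq_mul]
      exact ENNReal.inv_mul_cancel (by exact_mod_cast (hA n).card_pos.ne')
        (ENNReal.natCast_ne_top _)⟩
    have hPint : ∀ n (f : BoundedContinuousFunction X ℝ),
        ∫ y, f y ∂(P n) = (∑ u ∈ A n, f (u +ᵥ x)) / (A n).card := fun n f => by
      simp only [hP]
      rw [integral_smul_measure, integral_finsetSum_measure]
      · simp only [integral_dirac, ENNReal.toReal_inv, ENNReal.toReal_natCast, smul_eq_mul]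
        rw [div_eq_inv_mul]
      · exact fun u _ => f.integrable _
    set ν : ℕ → ProbabilityMeasure X := fun n => ⟨P n, hPprob n⟩
    set U : Ultrafilter (ProbabilityMeasure X) := (hyperfilter ℕ).map ν
    have hU : Tendsto ν (hyperfilter ℕ : Filter ℕ) (𝓝 U.lim) := U.le_nhds_lim
    rw [ProbabilityMeasure.tendsto_iff_forall_integral_tendsto] at hU
    generalize U.lim = L at hU
    have hhyp : (hyperfilter ℕ : Filter ℕ) ≤ atTop := by
      rw [← Nat.cofinite_eq_atTop]; exact hyperfilter_le_cofinite
    refine ⟨L, inferInstance, ⟨fun g s hs => ?_⟩⟩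
    have hmeas : Measurable fun y : X => g +ᵥ y := (continuous_const_vadd g).measurable
    have hprob : IsProbabilityMeasure ((L : Measure X).map (g +ᵥ ·)) :=
      Measure.isProbabilityMeasure_map hmeas.aemeasurable
    have hmap : (L : Measure X).map (g +ᵥ ·) = L := by
      refine ext_of_forall_integral_eq_of_IsFiniteMeasure fun f => ?_
      rw [integral_map hmeas.aemeasurable f.continuous.aestronglyMeasurable]
      set f' : BoundedContinuousFunction X ℝ :=
        f.compContinuous ⟨fun y => g +ᵥ y, continuous_const_vadd g⟩ with hf'
      have h1 : Tendsto (fun n => ∫ y, f' y ∂(P n) - ∫ y, f y ∂(P n)) (hyperfilter ℕ : Filter ℕ)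
        (𝓝 (∫ y, f' y ∂(L : Measure X) - ∫ y, f y ∂(L : Measure X))) := (hU f').sub (hU f)
      -- No Følner property is needed: since `G` is commutative, the average of `f'` at `x` is the
      -- average of `f` at `g +ᵥ x`, and both are close to the same constant.
      have h2 : Tendsto (fun n => ∫ y, f' y ∂(P n) - ∫ y, f y ∂(P n)) atTop (𝓝 0) := by
        rw [Metric.tendsto_atTop]
        intro ε hε
        obtain ⟨c, n₀, hn₀⟩ := havg f (ε / 3) (by positivity)
        refine ⟨n₀, fun n hn => ?_⟩
        have e1 := hn₀ n hn x
        have e2 := hn₀ n hn (g +ᵥ x)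
        have e3 : ∑ u ∈ A n, f' (u +ᵥ x) = ∑ u ∈ A n, f (u +ᵥ (g +ᵥ x)) :=
          Finset.sum_congr rfl fun u _ => by
            change f (g +ᵥ (u +ᵥ x)) = _
            rw [vadd_comm]
        rw [hPint, hPint, e3, Real.dist_eq, sub_zero, ← sub_div, abs_div, abs_of_pos (hcard n),
          div_lt_iff₀ (hcard n)]
        have := hcard n
        have h3 : |∑ u ∈ A n, f (u +ᵥ (g +ᵥ x)) - ∑ u ∈ A n, f (u +ᵥ x)| ≤
            ε / 3 * (A n).card + ε / 3 * (A n).card := by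
          rw [abs_le] at e1 e2 ⊢
          constructor <;> linarith [e1.1, e1.2, e2.1, e2.2]
        nlinarith
      exact sub_eq_zero.1 (tendsto_nhds_unique h1 (h2.mono_left hhyp))
    rw [← Measure.map_apply hmeas hs, hmap]
  · rintro μ μ' ⟨hμ, hμi⟩ ⟨hμ', hμi'⟩
    refine ext_of_forall_integral_eq_of_IsFiniteMeasure fun f => ?_
    -- Integrating the averages against an invariant measure returns `∫ f`, which is therefore as
    -- close to `c` as the averages are.
    have key : ∀ (μ : Measure X), IsProbabilityMeasure μ → VAddInvariantMeasure G X μ →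
        ∀ c ε n, (∀ y, |∑ u ∈ A n, f (u +ᵥ y) - (A n).card * c| ≤ ε * (A n).card) →
        |∫ y, f y ∂μ - c| ≤ ε := by
      intro μ hμ hμi c ε n hy
      have hint : ∀ u : G, ∫ y, f (u +ᵥ y) ∂μ = ∫ y, f y ∂μ := fun u => by
        have hmeas : Measurable fun y : X => u +ᵥ y := (continuous_const_vadd u).measurable
        have hmap : μ.map (u +ᵥ ·) = μ := by
          ext s hs
          rw [Measure.map_apply hmeas hs, hμi.measure_preimage_vadd u hs]
        conv_rhs => rw [← hmap]
        rw [integral_map hmeas.aemeasurable f.continuous.aestronglyMeasurable]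
      have hintegrable : ∀ u : G, Integrable (fun y => f (u +ᵥ y)) μ := fun u =>
        (f.compContinuous ⟨fun y => u +ᵥ y, continuous_const_vadd u⟩).integrable μ
      have h1 : ∫ y, (∑ u ∈ A n, f (u +ᵥ y) - (A n).card * c) ∂μ =
          (A n).card * (∫ y, f y ∂μ - c) := by
        rw [integral_sub (integrable_finsetSum _ fun u _ => hintegrable u) (integrable_const _),
          integral_finsetSum _ fun u _ => hintegrable u]
        simp [hint, mul_sub]
      have h2 : ‖∫ y, (∑ u ∈ A n, f (u +ᵥ y) - (A n).card * c) ∂μ‖ ≤ ε * (A n).card := by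
        have := norm_integral_le_of_norm_le_const (μ := μ)
          (f := fun y => ∑ u ∈ A n, f (u +ᵥ y) - (A n).card * c) (Eventually.of_forall hy)
        simpa using this
      rw [h1, Real.norm_eq_abs, abs_mul, abs_of_pos (hcard n), mul_comm] at h2
      exact le_of_mul_le_mul_right h2 (hcard n)
    refine eq_of_forall_dist_le fun ε hε => ?_
    obtain ⟨c, n₀, hn₀⟩ := havg f (ε / 2) (by positivity)
    have e1 := key μ hμ hμi c (ε / 2) n₀ (hn₀ n₀ le_rfl)
    have e2 := key μ' hμ' hμi' c (ε / 2) n₀ (hn₀ n₀ le_rfl)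
    rw [Real.dist_eq]
    rw [abs_le] at e1 e2 ⊢
    constructor <;> linarith [e1.1, e1.2, e2.1, e2.2]

open SymbolicDynamics.FullShift in
lemma exists_finset_forall_dist_le {G A : Type*} [AddCommGroup G] [TopologicalSpace A]
    [CompactSpace A] [DiscreteTopology A] {X : Subshift A G} {f : X.carrier → ℝ}
    (hf : Continuous f) {ε : ℝ} (hε : 0 < ε) :
    ∃ M : Finset G, ∀ y z : X.carrier, (∀ w ∈ M, y.1 w = z.1 w) → |f y - f z| ≤ ε := by
  classical
  have h1 : ∀ z : X.carrier, ∃ M : Finset G, ∀ y : X.carrier, (∀ w ∈ M, y.1 w = z.1 w) →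
      |f y - f z| < ε / 2 := fun z =>
    exists_finset_forall_eq_mem (U := {y | |f y - f z| < ε / 2})
      (isOpen_lt (hf.sub continuous_const).abs continuous_const)
      (by change |f z - f z| < ε / 2; rw [sub_self, abs_zero]; positivity)
  choose M hM using h1
  obtain ⟨t, ht⟩ := CompactSpace.elim_nhds_subcover
    (fun z => {y : X.carrier | ∀ w ∈ M z, y.1 w = z.1 w})
    fun z => (isOpen_setOf_forall_eq X (M z) z.1).mem_nhds fun _ _ => rfl
  refine ⟨t.biUnion M, fun y z hyz => ?_⟩
  obtain ⟨c, hc, hzc⟩ := Set.mem_iUnion₂.1 (ht.ge (Set.mem_univ z))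
  have e1 := hM c z hzc
  have e2 := hM c y fun w hw =>
    (hyz w (Finset.mem_biUnion.2 ⟨c, hc, hw⟩)).trans (hzc w hw)
  rw [abs_lt] at e1 e2
  rw [abs_le]
  constructor <;> linarith [e1.1, e1.2, e2.1, e2.2]

/-! ### Uniform averages and unique ergodicity -/

namespace BlockTower

variable {d k : ℕ} (B : BlockTower d k)

open scoped Classical in
/-- The points of the central cube that some element of `K` moves out of the cube. -/
noncomputable def boundary (K : Finset (Fin d → ℤ)) (n : ℕ) : Finset (Fin d → ℤ) :=
  (B.cube n).filter fun u => ∃ w ∈ K, u + w ∉ B.cube n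

lemma cube_nonempty (n : ℕ) : (B.cube n).Nonempty := by
  rw [← Finset.card_pos, card_cube]
  exact pow_pos (B.m_pos_nat n) _

lemma card_cube_pos (n : ℕ) : (0 : ℝ) < (B.cube n).card := by
  exact_mod_cast (B.cube_nonempty n).card_pos

lemma tendsto_m : Tendsto (fun n => (B.m n : ℝ)) atTop atTop := by
  refine tendsto_atTop_mono (fun n => ?_) tendsto_natCast_atTop_atTop
  have h := B.corner_le n
  have : n ≤ B.m n := by omega
  exact_mod_cast this

lemma tendsto_boundary_singleton (g : Fin d → ℤ) :
    Tendsto (fun n => ((B.boundary {g} n).card : ℝ) / (B.cube n).card) atTop (𝓝 0) := by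
  classical
  have hgood : ∀ n, ((B.cube n).filter fun u => u + g ∈ B.cube n).card =
      ∏ i, ((B.m n : ℤ) - |g i|).toNat := by
    intro n
    have : ((B.cube n).filter fun u => u + g ∈ B.cube n) = Fintype.piFinset fun i =>
        Finset.Ico (max (B.corner n) (B.corner n - g i))
          (min (B.corner n + B.m n) (B.corner n + B.m n - g i)) := by
      ext u
      simp only [cube, Finset.mem_filter, Fintype.mem_piFinset, Finset.mem_Ico, Pi.add_apply,
        ← forall_and, max_le_iff, lt_min_iff]
      refine forall_congr' fun i => ?_
      constructor <;> intro h <;> omega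
    rw [this, Fintype.card_piFinset]
    refine Finset.prod_congr rfl fun i _ => ?_
    rw [Int.card_Ico]
    congr 1
    rcases abs_cases (g i) with h | h <;> omega
  have hlim : Tendsto (fun n => ∏ i : Fin d, ((((B.m n : ℤ) - |g i|).toNat : ℝ) / B.m n)) atTop
      (𝓝 1) := by
    rw [← Finset.prod_const_one (s := (Finset.univ : Finset (Fin d)))]
    refine tendsto_finsetProd _ fun i _ => ?_
    have h1 : Tendsto (fun n => 1 - (|g i| : ℝ) / B.m n) atTop (𝓝 (1 - 0)) :=
      tendsto_const_nhds.sub (B.tendsto_m.const_div_atTop _)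
    rw [sub_zero] at h1
    refine h1.congr' ?_
    filter_upwards [B.tendsto_m.eventually_ge_atTop (|g i| : ℝ)] with n hn
    have hm : (0 : ℝ) < B.m n := by exact_mod_cast B.m_pos_nat n
    have h2 : (0 : ℤ) ≤ (B.m n : ℤ) - |g i| := by
      have : |g i| ≤ (B.m n : ℤ) := by exact_mod_cast hn
      omega
    have h3 : ((((B.m n : ℤ) - |g i|).toNat : ℤ) : ℝ) = (B.m n : ℝ) - |(g i : ℝ)| := by
      rw [Int.toNat_of_nonneg h2]; push_cast; rfl
    rw [Int.cast_natCast] at h3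
    rw [h3]
    field_simp
  have h4 : Tendsto (fun n => 1 - ∏ i : Fin d, ((((B.m n : ℤ) - |g i|).toNat : ℝ) / B.m n)) atTop
      (𝓝 (1 - 1)) := tendsto_const_nhds.sub hlim
  rw [sub_self] at h4
  refine h4.congr fun n => ?_
  have h5 : (B.boundary {g} n).card + ∏ i, ((B.m n : ℤ) - |g i|).toNat = (B.cube n).card := by
    rw [← hgood, add_comm, ← Finset.card_filter_add_card_filter_not (s := B.cube n)
      fun u => u + g ∈ B.cube n]
    simp [boundary]
  have h6 : ((B.boundary {g} n).card : ℝ) + ∏ i, ((((B.m n : ℤ) - |g i|).toNat : ℕ) : ℝ) =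
      (B.cube n).card := by exact_mod_cast h5
  have hc := B.card_cube_pos n
  rw [Finset.prod_div_distrib, eq_div_iff hc.ne', sub_mul, one_mul, ← h6]
  have : ∏ _i : Fin d, (B.m n : ℝ) = (B.cube n).card := by
    simp [card_cube]
  rw [this, h6, div_mul_cancel₀ _ hc.ne']
  linarith

theorem tendsto_boundary (K : Finset (Fin d → ℤ)) :
    Tendsto (fun n => ((B.boundary K n).card : ℝ) / (B.cube n).card) atTop (𝓝 0) := by
  classical
  have h1 : Tendsto (fun n => ∑ g ∈ K, ((B.boundary {g} n).card : ℝ) / (B.cube n).card) atTop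
      (𝓝 (∑ _g ∈ K, 0)) := tendsto_finsetSum _ fun g _ => B.tendsto_boundary_singleton g
  rw [Finset.sum_const_zero] at h1
  refine squeeze_zero (fun n => by positivity) (fun n => ?_) h1
  rw [← Finset.sum_div]
  gcongr
  have h2 : B.boundary K n ⊆ K.biUnion fun g => B.boundary {g} n := by
    intro u hu
    simp only [boundary, Finset.mem_filter, Finset.mem_biUnion, Finset.mem_singleton,
      exists_eq_left] at hu ⊢
    obtain ⟨hu, w, hw, h⟩ := hu
    exact ⟨w, hw, hu, h⟩
  exact_mod_cast (Finset.card_le_card h2).trans Finset.card_biUnion_le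

lemma eventually_boundary_le (K : Finset (Fin d → ℤ)) {δ : ℝ} (hδ : 0 < δ) :
    ∃ n₀, ∀ n ≥ n₀, ((B.boundary K n).card : ℝ) ≤ δ * (B.cube n).card := by
  obtain ⟨n₀, hn₀⟩ := eventually_atTop.1 ((B.tendsto_boundary K).eventually (ge_mem_nhds hδ))
  exact ⟨n₀, fun n hn => (div_le_iff₀ (B.card_cube_pos n)).1 (hn₀ n hn)⟩

lemma sum_tile (n : ℕ) (F : Finset (Fin d → ℤ))
    (hF : ∀ u ∈ F, ∀ u', B.tile n u' = B.tile n u → u' ∈ F) (ψ : (Fin d → ℤ) → ℝ) :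
    ∑ u ∈ F, ψ u =
      ∑ v ∈ F.image (B.tile n), ∑ w ∈ B.cube n, ψ ((B.m n : ℤ) • v + w) := by
  rw [← Finset.sum_fiberwise_of_maps_to (g := B.tile n) (t := F.image (B.tile n))
    fun u hu => Finset.mem_image_of_mem _ hu]
  refine Finset.sum_congr rfl fun v hv => ?_
  obtain ⟨u₀, hu₀, rfl⟩ := Finset.mem_image.1 hv
  symm
  refine Finset.sum_bij' (fun w _ => (B.m n : ℤ) • B.tile n u₀ + w)
    (fun u _ => u - (B.m n : ℤ) • B.tile n u₀) (fun w hw => ?_) (fun u hu => ?_)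
    (fun w _ => by abel) (fun u _ => by abel) fun w _ => rfl
  · have h : B.tile n ((B.m n : ℤ) • B.tile n u₀ + w) = B.tile n u₀ := by
      rw [add_comm, tile_add, B.mem_cube.1 hw, zero_add]
    exact Finset.mem_filter.2 ⟨hF u₀ hu₀ _ h, h⟩
  · rw [mem_cube, sub_eq_add_neg, ← smul_neg, tile_add, (Finset.mem_filter.1 hu).2,
      add_neg_cancel]

lemma abs_sum_tile_le (n : ℕ) (F : Finset (Fin d → ℤ))
    (hF : ∀ u ∈ F, ∀ u', B.tile n u' = B.tile n u → u' ∈ F) (ψ : (Fin d → ℤ) → ℝ) (η : ℝ)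
    (hψ : ∀ v, |∑ w ∈ B.cube n, ψ ((B.m n : ℤ) • v + w)| ≤ η * (B.cube n).card) :
    |∑ u ∈ F, ψ u| ≤ η * F.card := by
  have h1 := B.sum_tile n F hF fun _ => 1
  simp only [Finset.sum_const, nsmul_eq_mul, mul_one] at h1
  rw [B.sum_tile n F hF ψ, h1]
  refine (Finset.abs_sum_le_sum_abs _ _).trans ((Finset.sum_le_sum fun v _ => hψ v).trans ?_)
  rw [Finset.sum_const, nsmul_eq_mul]
  linarith

lemma image_tile_cube_succ (n : ℕ) : (B.cube (n + 1)).image (B.tile n) =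
    Fintype.piFinset fun _ : Fin d => Finset.Ico (-1 : ℤ) (B.N n - 1) := by
  ext t
  rw [mem_box_iff, Finset.mem_image]
  constructor
  · rintro ⟨u, hu, rfl⟩
    rw [← tile_succ, ← mem_cube]
    exact hu
  · intro ht
    obtain ⟨u, hu⟩ := B.cube_nonempty n
    have h : B.tile n (u + (B.m n : ℤ) • t) = t := by
      rw [tile_add, B.mem_cube.1 hu, zero_add]
    exact ⟨_, by rw [mem_cube, tile_succ, h, ht], h⟩

lemma exists_symbol_eq' (n : ℕ) (a : Fin (B.Q n + 1)) : ∃ t, B.symbol n t = a :=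
  let ⟨t, _, ht⟩ := B.exists_symbol_eq n 0 a
  ⟨t, ht⟩

/-- A function that depends approximately on a finite window of the array has uniform averages
along the cubes. -/
theorem exists_uniform_average (φ : (Fin d → ℤ) → ℝ) (C : ℝ) (hC : ∀ u, |φ u| ≤ C)
    (hφ : ∀ ε > 0, ∃ M : Finset (Fin d → ℤ), ∀ u u',
      (∀ w ∈ M, B.array (u + w) = B.array (u' + w)) → |φ u - φ u'| ≤ ε)
    {ε : ℝ} (hε : 0 < ε) :
    ∃ c : ℝ, ∃ n₀, ∀ n ≥ n₀, ∀ g,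
      |∑ u ∈ B.cube n, φ (g + u) - (B.cube n).card * c| ≤ ε * (B.cube n).card := by
  classical
  have hC0 : 0 ≤ C := (abs_nonneg _).trans (hC 0)
  set η := ε / 3 with hη
  have hη0 : 0 < η := by positivity
  obtain ⟨M, hM⟩ := hφ (η / 2) (by positivity)
  obtain ⟨n, hn⟩ := B.eventually_boundary_le M (δ := η / 2 / (2 * C + 1)) (by positivity)
  replace hn := hn n le_rfl
  choose s hs using B.exists_symbol_eq' n
  set S : Fin (B.Q n + 1) → ℝ := fun a => ∑ w ∈ B.cube n, φ ((B.m n : ℤ) • s a + w) with hS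
  have hcp := B.card_cube_pos n
  -- The sum over a level `n` cube depends, up to an error, only on its symbol. Half of the error
  -- comes from `hM`; the other half comes from boundary points, each costing at most `2 * C`.
  have step1 : ∀ t, |∑ w ∈ B.cube n, φ ((B.m n : ℤ) • t + w) - S (B.symbol n t)| ≤
      η * (B.cube n).card := by
    intro t
    rw [hS, ← Finset.sum_sub_distrib]
    have h1 : ∀ w ∈ B.cube n, |φ ((B.m n : ℤ) • t + w) - φ ((B.m n : ℤ) • s (B.symbol n t) + w)| ≤
        η / 2 + if w ∈ B.boundary M n then 2 * C else 0 := by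
      intro w hw
      split_ifs with hb
      · have e1 := hC ((B.m n : ℤ) • t + w)
        have e2 := hC ((B.m n : ℤ) • s (B.symbol n t) + w)
        rw [abs_le] at e1 e2 ⊢
        constructor <;> linarith [e1.1, e1.2, e2.1, e2.2]
      · rw [add_zero]
        refine hM _ _ fun z hz => ?_
        have hwz : B.tile n (w + z) = 0 := by
          rw [← mem_cube]
          by_contra hcon
          exact hb (Finset.mem_filter.2 ⟨hw, z, hz, hcon⟩)
        have key : ∀ t', B.array ((B.m n : ℤ) • t' + w + z) =
            B.eval n (B.symbol n t') (w + z) := fun t' => by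
          rw [show (B.m n : ℤ) • t' + w + z = (w + z) + (B.m n : ℤ) • t' by abel, B.array_eq n,
            tile_add, hwz, zero_add, eval_periodic]
        rw [key, key, hs]
    refine (Finset.abs_sum_le_sum_abs _ _).trans ((Finset.sum_le_sum h1).trans ?_)
    rw [Finset.sum_add_distrib, ← Finset.sum_filter]
    simp only [Finset.sum_const, nsmul_eq_mul]
    have h2 : (((B.cube n).filter fun w => w ∈ B.boundary M n).card : ℝ) ≤
        (B.boundary M n).card := by
      exact_mod_cast Finset.card_le_card fun w hw => (Finset.mem_filter.1 hw).2
    have h3 : ((B.boundary M n).card : ℝ) * (2 * C) ≤ η / 2 * (B.cube n).card := by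
      have h4 : (η / 2 / (2 * C + 1) * (B.cube n).card) * (2 * C + 1) =
          η / 2 * (B.cube n).card := by field_simp
      have h5 : (0 : ℝ) ≤ (B.boundary M n).card := by positivity
      nlinarith
    nlinarith
  set R : ℝ := ∑ a, B.r n • S a with hR
  -- By balance each symbol occurs `r n` times in a level `n + 1` cube, so the main term `R` is the
  -- same for all of them.
  have step2 : ∀ v, |∑ w ∈ B.cube (n + 1), φ ((B.m (n + 1) : ℤ) • v + w) - R| ≤
      η * (B.cube (n + 1)).card := by
    intro v
    have hcube : ∀ u ∈ B.cube (n + 1), ∀ u', B.tile n u' = B.tile n u → u' ∈ B.cube (n + 1) := by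
      intro u hu u' h
      rw [mem_cube, tile_succ] at hu ⊢
      rw [h, hu]
    have hcount := B.sum_tile n _ hcube fun _ => 1
    have hsum := B.sum_tile n _ hcube fun w => φ ((B.m (n + 1) : ℤ) • v + w)
    simp only [Finset.sum_const, nsmul_eq_mul, mul_one] at hcount
    rw [image_tile_cube_succ] at hcount hsum
    have hRsum : R = ∑ t ∈ Fintype.piFinset fun _ : Fin d => Finset.Ico (-1 : ℤ) (B.N n - 1),
        S (B.τ n (B.symbol (n + 1) v) t) := by
      rw [← Finset.sum_fiberwise _ (B.τ n (B.symbol (n + 1) v))]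
      refine Finset.sum_congr rfl fun a _ => ?_
      rw [Finset.sum_congr rfl fun t ht => by rw [(Finset.mem_filter.1 ht).2], Finset.sum_const,
        B.balanced]
    rw [hsum, hRsum, ← Finset.sum_sub_distrib, hcount]
    refine (Finset.abs_sum_le_sum_abs _ _).trans ((Finset.sum_le_sum
      (g := fun _ => η * ((B.cube n).card : ℝ)) fun t ht => ?_).trans ?_)
    · have h1 := step1 (t + (B.N n : ℤ) • v)
      have h2 : B.symbol n (t + (B.N n : ℤ) • v) = B.τ n (B.symbol (n + 1) v) t := by
        rw [symbol_eq, parent_add, B.mem_box_iff.1 ht, zero_add, τ_periodic]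
      rw [h2] at h1
      rw [Finset.sum_congr rfl fun w _ => by
        rw [show (B.m (n + 1) : ℤ) • v + ((B.m n : ℤ) • t + w) =
          (B.m n : ℤ) • (t + (B.N n : ℤ) • v) + w by
            rw [m_succ, smul_add, smul_smul, Nat.cast_mul]; abel]]
      exact h1
    · rw [Finset.sum_const, nsmul_eq_mul]
      linarith
  set p : ℝ := ((B.cube (n + 1)).card : ℝ) with hp
  have hp0 : 0 < p := B.card_cube_pos (n + 1)
  set c := R / p with hc
  have hcp' : p * c = R := by rw [hc]; field_simp
  have hcC : |c| ≤ C + η := by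
    have h1 := step2 0
    have h2 : |∑ w ∈ B.cube (n + 1), φ ((B.m (n + 1) : ℤ) • (0 : Fin d → ℤ) + w)| ≤ p * C := by
      refine (Finset.abs_sum_le_sum_abs _ _).trans ((Finset.sum_le_sum fun t _ => hC _).trans ?_)
      rw [Finset.sum_const, nsmul_eq_mul]
    have h3 : |R| ≤ p * (C + η) := by
      rw [abs_le] at h1 h2 ⊢
      constructor <;> nlinarith [h1.1, h1.2, h2.1, h2.2]
    rw [hc, abs_div, abs_of_pos hp0, div_le_iff₀ hp0]
    linarith
  open scoped Pointwise in
  obtain ⟨n₀, hn₀⟩ := B.eventually_boundary_le (B.cube (n + 1) - B.cube (n + 1))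
    (δ := η / (2 * C + η)) (by positivity)
  refine ⟨c, n₀, fun l hl g => ?_⟩
  replace hn₀ := hn₀ l hl
  set F : Finset (Fin d → ℤ) := (B.cube l).image (g + ·) with hF
  have hFsum : ∑ u ∈ B.cube l, φ (g + u) - (B.cube l).card * c = ∑ u ∈ F, (φ u - c) := by
    rw [hF, Finset.sum_image fun _ _ _ _ h => add_left_cancel h, Finset.sum_sub_distrib,
      Finset.sum_const, nsmul_eq_mul]
  -- `P` selects the points of `F` whose level `n + 1` cube lies entirely in `F`. The others form a
  -- boundary layer, and there `|φ - c| ≤ 2 * C + η`.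
  set P : (Fin d → ℤ) → Prop := fun u => ∀ u', B.tile (n + 1) u' = B.tile (n + 1) u → u' ∈ F
  have hgood : |∑ u ∈ F.filter P, (φ u - c)| ≤ η * (F.filter P).card := by
    refine B.abs_sum_tile_le (n + 1) _ (fun u hu u' h => ?_) _ η fun v => ?_
    · rw [Finset.mem_filter] at hu ⊢
      exact ⟨hu.2 u' h, fun u'' h' => hu.2 u'' (h'.trans h)⟩
    · rw [Finset.sum_sub_distrib, Finset.sum_const, nsmul_eq_mul, hcp']
      exact step2 v
  have hbadcard : ((F.filter fun u => ¬ P u).card : ℝ) ≤ η / (2 * C + η) * (B.cube l).card := by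
    refine le_trans ?_ hn₀
    have hsub : (F.filter fun u => ¬ P u) ⊆
        (B.boundary (B.cube (n + 1) - B.cube (n + 1)) l).image (g + ·) := by
      intro u hu
      obtain ⟨huF, hu⟩ := Finset.mem_filter.1 hu
      obtain ⟨u₁, hu₁, rfl⟩ := Finset.mem_image.1 huF
      simp only [P, not_forall] at hu
      obtain ⟨u', h, hu'⟩ := hu
      obtain ⟨z, hz, z', hz', hzz⟩ := B.sub_mem_sub_cube h
      refine Finset.mem_image_of_mem _ (Finset.mem_filter.2
        ⟨hu₁, z - z', Finset.sub_mem_sub hz hz', fun hcon => hu' ?_⟩)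
      refine Finset.mem_image.2 ⟨_, hcon, ?_⟩
      simp only [hzz]
      abel
    exact_mod_cast (Finset.card_le_card hsub).trans Finset.card_image_le
  have hbad : |∑ u ∈ F.filter fun u => ¬ P u, (φ u - c)| ≤
      (F.filter fun u => ¬ P u).card * (2 * C + η) := by
    refine (Finset.abs_sum_le_sum_abs _ _).trans ((Finset.sum_le_sum fun t _ => ?_).trans
      (b := ∑ u ∈ F.filter fun u => ¬ P u, (2 * C + η)) ?_)
    · have := hC t
      rw [abs_le] at this hcC ⊢
      constructor <;> linarith [this.1, this.2, hcC.1, hcC.2]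
    · rw [Finset.sum_const, nsmul_eq_mul]
  have hFcard : ((F.filter P).card : ℝ) ≤ (B.cube l).card := by
    exact_mod_cast (Finset.card_filter_le _ _).trans Finset.card_image_le
  rw [hFsum, ← Finset.sum_filter_add_sum_filter_not F P]
  refine (abs_add_le _ _).trans ?_
  have h7 : ((F.filter fun u => ¬ P u).card : ℝ) * (2 * C + η) ≤ η * (B.cube l).card := by
    calc _ ≤ η / (2 * C + η) * (B.cube l).card * (2 * C + η) := by gcongr
      _ = _ := by field_simp
  have h8 : η * ((F.filter P).card : ℝ) ≤ η * (B.cube l).card := by gcongr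
  have h9 : (0 : ℝ) < (B.cube l).card := B.card_cube_pos l
  have h10 : ε = 3 * η := by rw [hη]; ring
  rw [h10]
  nlinarith

theorem isUniquelyErgodic : IsUniquelyErgodic (Fin d → ℤ) B.shiftSpace := by
  refine isUniquelyErgodic_of_averages B.cube B.cube_nonempty fun f ε hε => ?_
  have hwin : ∀ δ > 0, ∃ M : Finset (Fin d → ℤ), ∀ u u',
      (∀ w ∈ M, B.array (u + w) = B.array (u' + w)) →
      |f (u +ᵥ B.base) - f (u' +ᵥ B.base)| ≤ δ := fun δ hδ => by
    obtain ⟨M, hM⟩ := exists_finset_forall_dist_le f.continuous hδ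
    exact ⟨M, fun u u' h => hM _ _ h⟩
  obtain ⟨c, n₀, hn₀⟩ := B.exists_uniform_average (fun u => f (u +ᵥ B.base)) ‖f‖
    (fun u => f.norm_coe_le_norm _) hwin hε
  refine ⟨c, n₀, fun n hn y => ?_⟩
  have hcl : IsClosed {y | |∑ u ∈ B.cube n, f (u +ᵥ y) - (B.cube n).card * c| ≤
      ε * (B.cube n).card} := by
    refine isClosed_le ?_ continuous_const
    exact ((continuous_finsetSum _ fun u _ =>
      f.continuous.comp (continuous_const_vadd u)).sub continuous_const).abs
  -- The estimate is a closed condition, so it passes from the orbit of the base point to all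
  -- points.
  have hdense := B.isMinimal.dense_orbit B.base
  refine hcl.closure_subset_iff.2 ?_ (hdense y)
  rintro _ ⟨g, rfl⟩
  have h1 := hn₀ n hn g
  simp only [add_comm g, add_vadd] at h1
  exact h1

theorem isStrictlyErgodic : IsStrictlyErgodic (Fin d → ℤ) B.shiftSpace :=
  ⟨B.isMinimal, B.isUniquelyErgodic⟩

end BlockTower

/-! ## Shearer's inequality -/

section Shearer

variable {I A : Type*}

/-- The number of restrictions of elements of `S` to `F`. -/
noncomputable def patternCount (F : Finset I) (S : Set (I → A)) : ℕ :=
  ((fun y : I → A => F.restrict y) '' S).ncard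

variable [Finite A]

lemma patternCount_mono (F : Finset I) {S S' : Set (I → A)} (h : S ⊆ S') :
    patternCount F S ≤ patternCount F S' :=
  Set.ncard_le_ncard (Set.image_mono h) (Set.toFinite _)

lemma patternCount_pos (F : Finset I) {S : Set (I → A)} (h : S.Nonempty) :
    0 < patternCount F S :=
  (Set.ncard_pos (Set.toFinite _)).2 (h.image _)

lemma patternCount_eq_sum [Fintype A] {F : Finset I} {i : I} (hi : i ∈ F) (S : Set (I → A)) :
    patternCount F S = ∑ a, patternCount F {y ∈ S | y i = a} := by
  have h : (fun y : I → A => F.restrict y) '' S =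
      ⋃ a, (fun y : I → A => F.restrict y) '' {y ∈ S | y i = a} := by
    ext z
    simp
  rw [patternCount, h, Set.ncard_iUnion_of_finite (fun _ => Set.toFinite _), finsum_eq_sum_of_fintype]
  · rfl
  · intro a b hab
    rw [Function.onFun, Set.disjoint_left]
    rintro _ ⟨y, hy, rfl⟩ ⟨y', hy', h⟩
    exact hab (by rw [← hy.2, ← hy'.2]; exact (congrFun h ⟨i, hi⟩).symm)

lemma patternCount_insert_le [DecidableEq I] (F : Finset I) (i : I) (a : A) (S : Set (I → A)) :
    patternCount (insert i F) {y ∈ S | y i = a} ≤ patternCount F {y ∈ S | y i = a} := by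
  refine Set.ncard_le_ncard_of_injOn
    (fun z (j : F) => z ⟨j.1, Finset.mem_insert_of_mem j.2⟩) ?_ ?_ (Set.toFinite _)
  · rintro _ ⟨y, hy, rfl⟩
    exact ⟨y, hy, rfl⟩
  · rintro _ ⟨y, hy, rfl⟩ _ ⟨y', hy', rfl⟩ h
    ext ⟨j, hj⟩
    rcases Finset.mem_insert.1 hj with rfl | hj'
    · exact hy.2.trans hy'.2.symm
    · exact congrFun h ⟨j, hj'⟩

lemma prod_le_avg_pow {κ : Type*} (T : Finset κ) (hT : T.Nonempty) (z : κ → ℝ)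
    (hz : ∀ v ∈ T, 0 ≤ z v) : ∏ v ∈ T, z v ≤ ((∑ v ∈ T, z v) / T.card) ^ T.card := by
  have hc : (0 : ℝ) < T.card := by exact_mod_cast hT.card_pos
  have h := Real.geom_mean_le_arith_mean T (fun _ => 1) z (fun _ _ => zero_le_one)
    (by simpa using hT) hz
  simp only [Real.rpow_one, Finset.sum_const, nsmul_eq_mul, mul_one, one_mul] at h
  have h2 := pow_le_pow_left₀ (Real.rpow_nonneg (Finset.prod_nonneg hz) _) h T.card
  rwa [← Real.rpow_natCast, ← Real.rpow_mul (Finset.prod_nonneg hz), inv_mul_cancel₀ hc.ne',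
    Real.rpow_one] at h2

/-- **Shearer's inequality**, combinatorial form. -/
theorem patternCount_pow_le {κ : Type*} (T : Finset κ) (F : κ → Finset I) {t : ℕ} (ht : 0 < t)
    (D : Finset I) : (∀ i ∈ D, ∃ T' ⊆ T, T'.card = t ∧ ∀ v ∈ T', i ∈ F v) →
    ∀ S : Set (I → A), patternCount D S ^ t ≤ ∏ v ∈ T, patternCount (F v) S := by
  classical
  have := Fintype.ofFinite A
  induction D using Finset.induction_on with
  | empty =>
    intro _ S
    rcases S.eq_empty_or_nonempty with rfl | hS
    · simp [patternCount, ht.ne']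
    · have h1 : patternCount (∅ : Finset I) S ≤ 1 :=
        Set.ncard_le_one_of_subsingleton _
      exact (pow_le_one₀ (Nat.zero_le _) h1).trans
        (Finset.one_le_prod' fun v _ => patternCount_pos (F v) hS)
  | insert i D _ ih =>
    intro hcov S
    rcases S.eq_empty_or_nonempty with rfl | hS
    · simp [patternCount, ht.ne']
    obtain ⟨T', hT', hcard, hiF⟩ := hcov i (Finset.mem_insert_self i D)
    have hT'ne : T'.Nonempty := Finset.card_pos.1 (hcard ▸ ht)
    set P : κ → ℝ := fun v => patternCount (F v) S with hP
    set p : κ → A → ℝ := fun v a => patternCount (F v) {y ∈ S | y i = a} with hp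
    set n : A → ℝ := fun a => patternCount D {y ∈ S | y i = a} with hn
    have hPpos : ∀ v, 0 < P v := fun v => Nat.cast_pos.2 (patternCount_pos (F v) hS)
    have hpP : ∀ v a, p v a ≤ P v := fun v a =>
      Nat.cast_le.2 (patternCount_mono (F v) (Set.sep_subset _ _))
    have hp0 : ∀ v a, 0 ≤ p v a := fun v a => Nat.cast_nonneg _
    have htR : (0 : ℝ) < t := by exact_mod_cast ht
    have hM : 0 < ∏ v ∈ T, P v := Finset.prod_pos fun v _ => hPpos v
    set α : ℝ := (∏ v ∈ T, P v) ^ ((t : ℝ)⁻¹) with hα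
    have hα0 : 0 ≤ α := Real.rpow_nonneg hM.le _
    have hαt : α ^ t = ∏ v ∈ T, P v := by
      rw [hα, ← Real.rpow_natCast, ← Real.rpow_mul hM.le, inv_mul_cancel₀ htR.ne', Real.rpow_one]
    -- The induction hypothesis for the slice `y i = a`; the factors outside `T'` are bounded by `P
    -- v`, and the `t` factors in `T'` are treated by the inequality of the means.
    have hna : ∀ a, n a ≤ α * ((∑ v ∈ T', p v a / P v) / t) := by
      intro a
      have h1 : n a ^ t ≤ ∏ v ∈ T, p v a := by
        have h := ih (fun j hj => hcov j (Finset.mem_insert_of_mem hj)) {y ∈ S | y i = a}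
        rw [← Nat.cast_le (α := ℝ), Nat.cast_pow, Nat.cast_prod] at h
        exact h
      have h2 : ∏ v ∈ T, p v a ≤ (∏ v ∈ T, P v) * ∏ v ∈ T', p v a / P v := by
        rw [← Finset.prod_sdiff hT', ← Finset.prod_sdiff hT' (f := P), mul_assoc,
          ← Finset.prod_mul_distrib]
        refine mul_le_mul (Finset.prod_le_prod (fun v _ => hp0 v a) fun v _ => hpP v a)
          (le_of_eq (Finset.prod_congr rfl fun v _ => ?_))
          (Finset.prod_nonneg fun v _ => hp0 v a) (Finset.prod_nonneg fun v _ => (hPpos v).le)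
        rw [mul_div_cancel₀ _ (hPpos v).ne']
      have h3 := prod_le_avg_pow T' hT'ne (fun v => p v a / P v)
        fun v _ => div_nonneg (hp0 v a) (hPpos v).le
      rw [hcard] at h3
      have h4 : n a ^ t ≤ (α * ((∑ v ∈ T', p v a / P v) / t)) ^ t := by
        rw [mul_pow, hαt]
        exact h1.trans (h2.trans (mul_le_mul_of_nonneg_left h3 hM.le))
      exact le_of_pow_le_pow_left₀ ht.ne' (mul_nonneg hα0 (div_nonneg (Finset.sum_nonneg
        fun v _ => div_nonneg (hp0 v a) (hPpos v).le) htR.le)) h4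
    have hsum : ∑ a, n a ≤ α := by
      refine (Finset.sum_le_sum fun a _ => hna a).trans (le_of_eq ?_)
      rw [← Finset.mul_sum, ← Finset.sum_div, Finset.sum_comm]
      -- As `i ∈ F v`, slicing by the value at `i` partitions the patterns on `F v`, so the averages
      -- add up to `1`.
      have : ∀ v ∈ T', ∑ a, p v a / P v = 1 := fun v hv => by
        have h5 : ∑ a, p v a = P v := by
          rw [hP, hp]
          simp only
          rw [patternCount_eq_sum (hiF v hv) S]
          push_cast
          rfl
        rw [← Finset.sum_div, h5, div_self (hPpos v).ne']
      rw [Finset.sum_congr rfl this, Finset.sum_const, hcard, nsmul_eq_mul, mul_one,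
        div_self htR.ne', mul_one]
    have hD : (patternCount (insert i D) S : ℝ) ≤ ∑ a, n a := by
      rw [patternCount_eq_sum (Finset.mem_insert_self i D) S]
      push_cast
      exact Finset.sum_le_sum fun a _ => Nat.cast_le.2 (patternCount_insert_le D i a S)
    have h6 : (patternCount (insert i D) S : ℝ) ^ t ≤ ∏ v ∈ T, P v := by
      rw [← hαt]
      exact pow_le_pow_left₀ (Nat.cast_nonneg _) (hD.trans hsum) t
    rw [← Nat.cast_le (α := ℝ), Nat.cast_pow, Nat.cast_prod]
    exact h6

end Shearer

/-! ## Følner sequences and pattern counts -/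

section Folner

open scoped Classical Pointwise

lemma card_add_le {G : Type*} [AddCommGroup G] [DecidableEq G] (F K : Finset G) :
    (F + K).card ≤ F.card + ∑ g ∈ K, ((g +ᵥ F) \ F).card := by
  have h : F + K ⊆ F ∪ K.biUnion fun g => (g +ᵥ F) \ F := by
    intro u hu
    obtain ⟨f, hf, g, hg, rfl⟩ := Finset.mem_add.1 hu
    by_cases h : f + g ∈ F
    · exact Finset.mem_union_left _ h
    · refine Finset.mem_union_right _ (Finset.mem_biUnion.2 ⟨g, hg, Finset.mem_sdiff.2 ⟨?_, h⟩⟩)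
      rw [add_comm f g]
      exact Finset.vadd_mem_vadd_finset hf
  exact (Finset.card_le_card h).trans ((Finset.card_union_le _ _).trans
    (Nat.add_le_add_left Finset.card_biUnion_le _))

namespace IsFolnerSequence

variable {G : Type*} [AddCommGroup G] {F : ℕ → Finset G}

lemma exists_card_add_div_le [DecidableEq G] (hF : IsFolnerSequence F) (K : Finset G) :
    ∃ b : ℕ → ℝ, Tendsto b atTop (𝓝 1) ∧ ∀ n, ((F n + K).card : ℝ) / (F n).card ≤ b n := by
  obtain rfl : ‹DecidableEq G› = fun a b => Classical.propDecidable (a = b) :=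
    Subsingleton.elim _ _
  refine ⟨fun n => 1 + ∑ g ∈ K, ((symmDiff (g +ᵥ F n) (F n)).card : ℝ) / (F n).card, ?_,
    fun n => ?_⟩
  · have h := (tendsto_const_nhds (x := (1 : ℝ))).add (tendsto_finsetSum K fun g _ => hF.2 g)
    simpa using h
  · have hc : (0 : ℝ) < (F n).card := by exact_mod_cast (hF.1 n).card_pos
    beta_reduce
    rw [← Finset.sum_div, div_le_iff₀ hc, add_mul, one_mul, div_mul_cancel₀ _ hc.ne']
    have h : (F n + K).card ≤ (F n).card + ∑ g ∈ K, (symmDiff (g +ᵥ F n) (F n)).card :=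
      (card_add_le _ _).trans (Nat.add_le_add_left (Finset.sum_le_sum fun g _ =>
        Finset.card_le_card (le_sup_left (a := (g +ᵥ F n) \ F n) (b := F n \ (g +ᵥ F n)))) _)
    exact_mod_cast h

/-- For a set of fewer than `C` elements, a symmetric difference of relative size below `1 / (|C| +
1)` has less than one element. -/
lemma eventually_vadd_mem (hF : IsFolnerSequence F) (g : G) (C : ℝ) :
    ∀ᶠ n in atTop, ((F n).card : ℝ) < C → ∀ u ∈ F n, g + u ∈ F n := by
  filter_upwards [(hF.2 g).eventually (gt_mem_nhds (show (0 : ℝ) < 1 / (|C| + 1) by positivity))]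
    with n hn hC u hu
  have hc : (0 : ℝ) < (F n).card := by exact_mod_cast (hF.1 n).card_pos
  rw [div_lt_div_iff₀ hc (by positivity)] at hn
  have h2 : (symmDiff (g +ᵥ F n) (F n)).card = 0 := by
    by_contra hne
    have h3 : (1 : ℝ) ≤ (symmDiff (g +ᵥ F n) (F n)).card := by
      exact_mod_cast Nat.one_le_iff_ne_zero.2 hne
    have := le_abs_self C
    have := abs_nonneg C
    nlinarith
  have h4 : g +ᵥ F n = F n := symmDiff_eq_bot.1 (Finset.card_eq_zero.1 h2)
  have h5 := Finset.vadd_mem_vadd_finset (a := g) hu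
  rwa [h4] at h5

lemma tendsto_card {d : ℕ} (hd : 1 ≤ d) {F : ℕ → Finset (Fin d → ℤ)}
    (hF : IsFolnerSequence F) : Tendsto (fun n => ((F n).card : ℝ)) atTop atTop := by
  refine tendsto_atTop.2 fun C => ?_
  filter_upwards [hF.eventually_vadd_mem (fun _ => 1) C] with n hn
  by_contra! hC
  obtain ⟨u, hu, hmax⟩ := Finset.exists_max_image (F n) (fun u => u ⟨0, hd⟩) (hF.1 n)
  have h6 := hmax _ (hn hC u hu)
  change 1 + u ⟨0, hd⟩ ≤ u ⟨0, hd⟩ at h6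
  omega

end IsFolnerSequence

variable {G : Type*} [AddCommGroup G] [DecidableEq G]

open SymbolicDynamics.FullShift in
lemma patternCount_vadd {A : Type*} [TopologicalSpace A] [Finite A] (X : Subshift A G)
    (v : G) (F : Finset G) :
    patternCount (F.image (v + ·)) X.carrier ≤ patternCount F X.carrier := by
  refine Set.ncard_le_ncard_of_injOn
    (fun z (j : F) => z ⟨v + j.1, Finset.mem_image_of_mem _ j.2⟩) ?_ ?_ (Set.toFinite _)
  · rintro _ ⟨y, hy, rfl⟩
    exact ⟨shift v y, X.mapsTo v hy, rfl⟩
  · intro z _ z' _ h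
    ext ⟨j, hj⟩
    obtain ⟨f, hf, rfl⟩ := Finset.mem_image.1 hj
    have h' := congrFun h ⟨f, hf⟩
    exact h'

open SymbolicDynamics.FullShift in
/-- Shearer's inequality for the translates of a set. -/
lemma patternCount_pow_card_le {A : Type*} [TopologicalSpace A] [Finite A] (X : Subshift A G)
    (D F : Finset G) (hF : F.Nonempty) :
    patternCount D X.carrier ^ F.card ≤ patternCount F X.carrier ^ (D + -F).card := by
  have h1 := patternCount_pow_le (D + -F) (fun v => F.image (v + ·)) hF.card_pos D
    -- The translate `v + F` contains `i` exactly for `v ∈ i - F`, so each point of `D` is covered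
    -- `F.card` times.
    (fun i hi => ⟨F.image (fun f => i - f), ?_, ?_, ?_⟩) X.carrier
  · refine h1.trans ((Finset.prod_le_prod' fun v _ => patternCount_vadd X v F).trans ?_)
    rw [Finset.prod_const]
  · intro u hu
    obtain ⟨f, hf, rfl⟩ := Finset.mem_image.1 hu
    rw [sub_eq_add_neg]
    exact Finset.add_mem_add hi (Finset.neg_mem_neg hf)
  · exact Finset.card_image_of_injective _ fun _ _ h => sub_right_injective h
  · intro u hu
    obtain ⟨f, hf, rfl⟩ := Finset.mem_image.1 hu
    exact Finset.mem_image.2 ⟨f, hf, sub_add_cancel _ _⟩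

end Folner

/-! ### Topological entropy -/

namespace BlockTower

variable {d k : ℕ} (B : BlockTower d k)

open scoped Pointwise

lemma le_patternCount_cube (n : ℕ) :
    B.Q n + 1 ≤ patternCount (B.cube n) (orbitClosure B.array).carrier := by
  choose s hs using B.exists_symbol_eq' n
  set f : Fin (B.Q n + 1) → (B.cube n → Fin k) := fun a =>
    (B.cube n).restrict
      (SymbolicDynamics.FullShift.shift ((B.m n : ℤ) • s a) B.array) with hf
  have hfinj : Function.Injective f := by
    intro a a' h
    by_contra hne
    obtain ⟨u, hu, hne'⟩ := B.eval_injective n a a' hne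
    have key : ∀ a, f a ⟨u, B.mem_cube.2 hu⟩ = B.eval n a u := fun a => by
      change B.array ((B.m n : ℤ) • s a + u) = _
      rw [add_comm, B.array_eq n, tile_add, hu, zero_add, hs, eval_periodic]
    exact hne' (by rw [← key, ← key, h])
  have h1 : (f '' Set.univ).ncard = B.Q n + 1 := by
    rw [Set.ncard_image_of_injective _ hfinj, Set.ncard_univ, Nat.card_eq_fintype_card,
      Fintype.card_fin]
  rw [← h1]
  refine Set.ncard_le_ncard ?_ (Set.toFinite _)
  rintro _ ⟨a, -, rfl⟩
  exact ⟨_, shift_mem_orbitClosure _ _, rfl⟩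

/-- The level `n` cubes that meet `g + F` are disjoint and contained in `g + F` enlarged by the
differences of the central cube. -/
lemma card_cube_mul_card_image_le (n : ℕ) (F : Finset (Fin d → ℤ)) (g : Fin d → ℤ) :
    (F.image fun u => B.tile n (g + u)).card * (B.cube n).card ≤
      (F + (B.cube n - B.cube n)).card := by
  rw [← Finset.card_product]
  have htile : ∀ v, ∀ w ∈ B.cube n, B.tile n ((B.m n : ℤ) • v + w) = v := fun v w hw => by
    rw [add_comm, tile_add, B.mem_cube.1 hw, zero_add]
  refine Finset.card_le_card_of_injOn (fun p => (B.m n : ℤ) • p.1 + p.2 - g) ?_ ?_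
  · intro p hp
    obtain ⟨hv, hw⟩ := Finset.mem_product.1 hp
    obtain ⟨f, hf, hv⟩ := Finset.mem_image.1 hv
    obtain ⟨u, hu, u', hu', h⟩ := B.sub_mem_sub_cube (n := n)
      (g := (B.m n : ℤ) • p.1 + p.2) (g' := g + f) (by rw [htile _ _ hw, hv])
    have h2 : (B.m n : ℤ) • p.1 + p.2 - g = f + (u - u') := by rw [h]; abel
    simp only [h2]
    exact Finset.add_mem_add hf (Finset.sub_mem_sub hu hu')
  · rintro ⟨v, w⟩ hp ⟨v', w'⟩ hp' h
    have hw := (Finset.mem_product.1 hp).2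
    have hw' := (Finset.mem_product.1 hp').2
    have h' : (B.m n : ℤ) • v + w = (B.m n : ℤ) • v' + w' := sub_left_injective h
    have hv : v = v' := by rw [← htile v w hw, h', htile v' w' hw']
    subst hv
    rw [add_left_cancel h']

lemma patternCount_le (n : ℕ) (F : Finset (Fin d → ℤ)) :
    patternCount F (orbitClosure B.array).carrier ≤
      (B.cube n).card * (B.Q n + 1) ^ ((F + (B.cube n - B.cube n)).card / (B.cube n).card) := by
  set J : (Fin d → ℤ) → Finset (Fin d → ℤ) := fun g => F.image fun u => B.tile n (g + u) with hJ
  set Ψ : ∀ g, (J g → Fin (B.Q n + 1)) → (F → Fin k) := fun g z u =>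
    B.eval n (z ⟨B.tile n (g + u.1), Finset.mem_image_of_mem _ u.2⟩) (g + u.1) with hΨ
  have hsub : (fun y : (Fin d → ℤ) → Fin k => F.restrict y) '' (orbitClosure B.array).carrier ⊆
      ⋃ g ∈ B.cube n, Set.range (Ψ g) := by
    rintro _ ⟨y, hy, rfl⟩
    obtain ⟨g, hg⟩ := exists_shift_eq_of_mem_orbitClosure hy F
    refine Set.mem_iUnion₂.2 ⟨g + (B.m n : ℤ) • (-B.tile n g), ?_,
      fun v => B.symbol n (v.1 + B.tile n g), ?_⟩
    · rw [mem_cube, tile_add, add_neg_cancel]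
    · funext u
      have e : g + u.1 = (g + (B.m n : ℤ) • (-B.tile n g) + u.1) + (B.m n : ℤ) • B.tile n g := by
        rw [smul_neg]; abel
      change B.eval n (B.symbol n (B.tile n (g + (B.m n : ℤ) • (-B.tile n g) + u.1) + B.tile n g))
        (g + (B.m n : ℤ) • (-B.tile n g) + u.1) = y u.1
      rw [hg u.1 u.2, B.array_eq n, e, tile_add, eval_periodic]
  have hcard : ∀ g, (Set.range (Ψ g)).ncard ≤
      (B.Q n + 1) ^ ((F + (B.cube n - B.cube n)).card / (B.cube n).card) := by
    intro g
    rw [← Set.image_univ]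
    refine (Set.ncard_image_le (Set.toFinite _)).trans ?_
    rw [Set.ncard_univ, Nat.card_eq_fintype_card, Fintype.card_fun, Fintype.card_fin,
      Fintype.card_coe]
    refine Nat.pow_le_pow_right (Nat.succ_pos _) ?_
    rw [Nat.le_div_iff_mul_le (B.cube_nonempty n).card_pos]
    exact B.card_cube_mul_card_image_le n F g
  refine (Set.ncard_le_ncard hsub (Set.toFinite _)).trans
    ((Finset.set_ncard_biUnion_le _ _).trans ((Finset.sum_le_sum fun g _ => hcard g).trans ?_))
  rw [Finset.sum_const, smul_eq_mul]

lemma tendsto_card_cube_add (K : Finset (Fin d → ℤ)) :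
    Tendsto (fun n => 1 + ∑ g ∈ K, ((B.boundary {g} n).card : ℝ) / (B.cube n).card) atTop
      (𝓝 1) := by
  have h := (tendsto_const_nhds (x := (1 : ℝ))).add
    (tendsto_finsetSum K fun g _ => B.tendsto_boundary_singleton g)
  simpa using h

lemma card_cube_add_le (K : Finset (Fin d → ℤ)) (n : ℕ) :
    ((B.cube n + K).card : ℝ) / (B.cube n).card ≤
      1 + ∑ g ∈ K, ((B.boundary {g} n).card : ℝ) / (B.cube n).card := by
  have hc := B.card_cube_pos n
  rw [← Finset.sum_div, div_le_iff₀ hc, add_mul, one_mul, div_mul_cancel₀ _ hc.ne']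
  have h : (B.cube n + K).card ≤ (B.cube n).card + ∑ g ∈ K, (B.boundary {g} n).card := by
    refine (card_add_le _ _).trans (Nat.add_le_add_left (Finset.sum_le_sum fun g _ => ?_) _)
    have hsub : (g +ᵥ B.cube n) \ B.cube n ⊆ (B.boundary {g} n).image (g + ·) := by
      intro u hu
      obtain ⟨hu, hu'⟩ := Finset.mem_sdiff.1 hu
      obtain ⟨w, hw, rfl⟩ := Finset.mem_vadd_finset.1 hu
      rw [vadd_eq_add] at hu'
      exact Finset.mem_image_of_mem _ (Finset.mem_filter.2
        ⟨hw, g, Finset.mem_singleton_self g, by rwa [add_comm]⟩)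
    exact (Finset.card_le_card hsub).trans Finset.card_image_le
  exact_mod_cast h

variable {B} {h : ℝ}

lemma le_log_succ_Q
    (hQ : ∀ n, B.Q n = ⌊Real.exp (h * (B.m n : ℝ) ^ d)⌋₊) (n : ℕ) : h * (B.cube n).card ≤ Real.log ((B.Q n + 1 : ℕ) : ℝ) := by
  rw [Real.le_log_iff_exp_le (by positivity), hQ, card_cube]
  push_cast
  exact (Nat.lt_floor_add_one _).le

lemma log_succ_Q_le (hpos : 0 < h)
    (hQ : ∀ n, B.Q n = ⌊Real.exp (h * (B.m n : ℝ) ^ d)⌋₊) (n : ℕ) :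
    Real.log ((B.Q n + 1 : ℕ) : ℝ) ≤ h * (B.cube n).card + Real.log 2 := by
  have h1 : (0 : ℝ) ≤ h * (B.m n : ℝ) ^ d := by positivity
  have h2 := Nat.floor_le (Real.exp_pos (h * (B.m n : ℝ) ^ d)).le
  have h3 := Real.one_le_exp h1
  rw [Real.log_le_iff_le_exp (by positivity), Real.exp_add, Real.exp_log two_pos, hQ, card_cube]
  push_cast
  linarith

/-- Shearer's inequality on the cubes `B.cube n`, whose pattern counts are known from below;
enlarging a cube by `-F` costs a factor tending to `1`. The bound holds for every nonempty finite
`F`. -/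
lemma mul_card_le_log
    (hQ : ∀ n, B.Q n = ⌊Real.exp (h * (B.m n : ℝ) ^ d)⌋₊) (F : Finset (Fin d → ℤ)) (hF : F.Nonempty) :
    h * F.card ≤ Real.log (patternCount F (orbitClosure B.array).carrier) := by
  set θ := patternCount F (orbitClosure B.array).carrier with hθ
  have hθ1 : 0 ≤ Real.log θ := Real.log_natCast_nonneg _
  have key : ∀ n, h * F.card ≤
      (1 + ∑ g ∈ -F, ((B.boundary {g} n).card : ℝ) / (B.cube n).card) * Real.log θ := by
    intro n
    have hc := B.card_cube_pos n
    have h1 := patternCount_pow_card_le (orbitClosure B.array) (B.cube n) F hF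
    have h2 : ((B.Q n + 1 : ℕ) : ℝ) ^ F.card ≤ (θ : ℝ) ^ (B.cube n + -F).card := by
      exact_mod_cast (Nat.pow_le_pow_left (B.le_patternCount_cube n) _).trans h1
    have h3 := Real.log_le_log (by positivity) h2
    rw [Real.log_pow, Real.log_pow] at h3
    have h4 := le_log_succ_Q hQ n
    have h5 : (F.card : ℝ) * (h * (B.cube n).card) ≤ (B.cube n + -F).card * Real.log θ :=
      (mul_le_mul_of_nonneg_left h4 (Nat.cast_nonneg _)).trans h3
    refine le_trans ?_ (mul_le_mul_of_nonneg_right (B.card_cube_add_le (-F) n) hθ1)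
    rw [div_mul_eq_mul_div, le_div_iff₀ hc]
    linarith
  have hlim := (B.tendsto_card_cube_add (-F)).mul_const (Real.log θ)
  rw [one_mul] at hlim
  exact ge_of_tendsto' hlim key

lemma log_le (hpos : 0 < h)
    (hQ : ∀ n, B.Q n = ⌊Real.exp (h * (B.m n : ℝ) ^ d)⌋₊) (n : ℕ) (F : Finset (Fin d → ℤ)) :
    Real.log (patternCount F (orbitClosure B.array).carrier) ≤
      Real.log (B.cube n).card +
        (F + (B.cube n - B.cube n)).card * (h + Real.log 2 / (B.cube n).card) := by
  have hne : (orbitClosure B.array).carrier.Nonempty := ⟨_, self_mem_orbitClosure _⟩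
  have hc := B.card_cube_pos n
  have h1 : (patternCount F (orbitClosure B.array).carrier : ℝ) ≤ (B.cube n).card *
      ((B.Q n + 1 : ℕ) : ℝ) ^ ((F + (B.cube n - B.cube n)).card / (B.cube n).card) := by
    exact_mod_cast B.patternCount_le n F
  have h2 := Real.log_le_log (by exact_mod_cast patternCount_pos F hne) h1
  rw [Real.log_mul hc.ne' (by positivity), Real.log_pow] at h2
  refine h2.trans (add_le_add_right ?_ _)
  have h3 : (((F + (B.cube n - B.cube n)).card / (B.cube n).card : ℕ) : ℝ) ≤
      ((F + (B.cube n - B.cube n)).card : ℝ) / (B.cube n).card := Nat.cast_div_le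
  have h4 := log_succ_Q_le hpos hQ n
  have h5 : 0 ≤ Real.log ((B.Q n + 1 : ℕ) : ℝ) := Real.log_natCast_nonneg _
  calc _ ≤ ((F + (B.cube n - B.cube n)).card : ℝ) / (B.cube n).card *
        (h * (B.cube n).card + Real.log 2) := by gcongr
    _ = _ := by field_simp

theorem hasTopologicalEntropy (hpos : 0 < h)
    (hQ : ∀ n, B.Q n = ⌊Real.exp (h * (B.m n : ℝ) ^ d)⌋₊) (hd : 1 ≤ d) :
    HasTopologicalEntropy (orbitClosure B.array) h := by
  intro F hF
  change Tendsto (fun n => Real.log (patternCount (F n) (orbitClosure B.array).carrier) /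
    (F n).card) atTop (𝓝 h)
  have hc : ∀ n, (0 : ℝ) < (F n).card := fun n => by exact_mod_cast (hF.1 n).card_pos
  have hcube : Tendsto (fun n => ((B.cube n).card : ℝ)) atTop atTop := by
    simp only [card_cube, Nat.cast_pow]
    exact (tendsto_pow_atTop (by omega)).comp B.tendsto_m
  rw [tendsto_order]
  refine ⟨fun a ha => Eventually.of_forall fun n => ha.trans_le ?_, fun a ha => ?_⟩
  · rw [le_div_iff₀ (hc n)]
    exact mul_card_le_log hQ (F n) (hF.1 n)
  · have h1 : Tendsto (fun n => h + Real.log 2 / (B.cube n).card) atTop (𝓝 (h + 0)) :=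
      tendsto_const_nhds.add (hcube.const_div_atTop _)
    rw [add_zero] at h1
    obtain ⟨n, hn⟩ := (h1.eventually (gt_mem_nhds ha)).exists
    set c := h + Real.log 2 / (B.cube n).card with hcdef
    have hc0 : 0 ≤ c := by have := Real.log_pos one_lt_two; positivity
    obtain ⟨b, hb, hFb⟩ := hF.exists_card_add_div_le (B.cube n - B.cube n)
    have h2 := ((hF.tendsto_card hd).const_div_atTop (Real.log (B.cube n).card)).add
      (hb.mul_const c)
    rw [zero_add, one_mul] at h2
    filter_upwards [h2.eventually (gt_mem_nhds hn)] with i hi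
    refine lt_of_le_of_lt ?_ hi
    have h3 := log_le hpos hQ n (F i)
    have h4 := mul_le_mul_of_nonneg_right (hFb i) hc0
    refine le_trans ?_ (add_le_add_right h4 _)
    rw [div_mul_eq_mul_div, ← add_div]
    exact div_le_div_of_nonneg_right h3 (hc i).le

end BlockTower

/-! ## Balanced arrangements -/

section Arrangements

variable {C : Type*} [Fintype C] [DecidableEq C]

/-- The arrangements in which each of the `Q + 1` symbols is used exactly `r` times. -/
def balancedArrangements (C : Type*) [Fintype C] [DecidableEq C] (Q r : ℕ) :
    Finset (C → Fin (Q + 1)) :=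
  Finset.univ.filter fun w => ∀ b, (Finset.univ.filter fun c => w c = b).card = r

lemma mem_balancedArrangements {Q r : ℕ} {w : C → Fin (Q + 1)} :
    w ∈ balancedArrangements C Q r ↔ ∀ b, (Finset.univ.filter fun c => w c = b).card = r := by
  simp [balancedArrangements]

/-- Pigeonhole: words of length `r` have at most `(r + 1) ^ (Q + 1)` vectors of letter counts. -/
lemma exists_fiber_pow_le (Q r : ℕ) : ∃ (y : Fin (Q + 1) → ℕ) (K : Finset (Fin r → Fin (Q + 1))),
    (∀ v ∈ K, ∀ b, (Finset.univ.filter fun i => v i = b).card = y b) ∧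
      (Q + 1) ^ r ≤ K.card * (r + 1) ^ (Q + 1) := by
  set f : (Fin r → Fin (Q + 1)) → (Fin (Q + 1) → Fin (r + 1)) := fun v b =>
    ⟨(Finset.univ.filter fun i => v i = b).card,
      Nat.lt_succ_of_le ((Finset.card_filter_le _ _).trans (by simp))⟩ with hf
  obtain ⟨y, -, hy⟩ := Finset.exists_max_image Finset.univ
    (fun y => (Finset.univ.filter fun v => f v = y).card) Finset.univ_nonempty
  refine ⟨fun b => y b, Finset.univ.filter fun v => f v = y, fun v hv b => ?_, ?_⟩
  · rw [← (Finset.mem_filter.1 hv).2]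
  · have h := Finset.card_le_mul_card_image_of_maps_to (f := f) (s := Finset.univ)
      (t := Finset.univ) (fun _ _ => Finset.mem_univ _) _ fun b _ => hy b (Finset.mem_univ b)
    simpa using h

/-- Cut `C` into `Q + 1` rows of length `r`, fill them with words having a common count vector `y`,
and shift the letters of row `j` cyclically by `j`. The letter `b` then occurs `∑ j, y (b - j) = r`
times in total. -/
lemma pow_le_card_balancedArrangements {Q r : ℕ} (hC : Fintype.card C = (Q + 1) * r) :
    (Q + 1) ^ Fintype.card C ≤
      (balancedArrangements C Q r).card * (r + 1) ^ ((Q + 1) ^ 2) := by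
  obtain ⟨y, K, hK, hcard⟩ := exists_fiber_pow_le Q r
  have hKne : K.Nonempty := by
    rw [← Finset.card_pos]
    by_contra! h0
    have h1 : 0 < (Q + 1) ^ r := by positivity
    rw [Nat.le_zero.1 h0, zero_mul] at hcard
    omega
  have hy : ∑ b, y b = r := by
    obtain ⟨v, hv⟩ := hKne
    have h := Finset.card_eq_sum_card_fiberwise (f := v) (s := Finset.univ) (t := Finset.univ)
      fun _ _ => Finset.mem_univ _
    rw [Finset.card_univ, Fintype.card_fin] at h
    rw [h]
    exact Finset.sum_congr rfl fun b _ => (hK v hv b).symm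
  have e : C ≃ Fin (Q + 1) × Fin r := Fintype.equivOfCardEq (by simp [hC])
  set Φ : (Fin (Q + 1) → K) → (C → Fin (Q + 1)) := fun v c => (v (e c).1).1 (e c).2 + (e c).1
    with hΦ
  have hΦinj : Function.Injective Φ := by
    intro v v' h
    funext j
    refine Subtype.ext (funext fun i => ?_)
    have h1 := congrFun h (e.symm (j, i))
    simpa [hΦ] using h1
  have hΦmem : ∀ v, Φ v ∈ balancedArrangements C Q r := by
    intro v
    rw [mem_balancedArrangements]
    intro b
    have h1 : (Finset.univ.filter fun c => Φ v c = b).card =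
        (Finset.univ.filter fun p : Fin (Q + 1) × Fin r => (v p.1).1 p.2 + p.1 = b).card := by
      refine Finset.card_equiv e fun c => ?_
      simp [hΦ]
    have h2 : (Finset.univ.filter fun p : Fin (Q + 1) × Fin r => (v p.1).1 p.2 + p.1 = b).card =
        ∑ j, (Finset.univ.filter fun i => (v j).1 i + j = b).card := by
      simp only [Finset.card_filter, Fintype.sum_prod_type]
    rw [h1, h2]
    refine Eq.trans ?_ ((Equiv.sum_comp (Equiv.subLeft b) y).trans hy)
    refine Finset.sum_congr rfl fun j _ => ?_
    rw [Equiv.subLeft_apply, ← hK (v j).1 (v j).2 (b - j)]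
    congr 1
    ext i
    simp [eq_sub_iff_add_eq]
  have h1 : K.card ^ (Q + 1) ≤ (balancedArrangements C Q r).card := by
    have h := Finset.card_le_card_of_injOn (s := Finset.univ) Φ (fun v _ => hΦmem v)
      hΦinj.injOn
    simpa using h
  calc (Q + 1) ^ Fintype.card C = ((Q + 1) ^ r) ^ (Q + 1) := by
        rw [hC, ← pow_mul, mul_comm]
    _ ≤ (K.card * (r + 1) ^ (Q + 1)) ^ (Q + 1) := Nat.pow_le_pow_left hcard _
    _ = K.card ^ (Q + 1) * (r + 1) ^ ((Q + 1) ^ 2) := by rw [mul_pow, ← pow_mul, sq]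
    _ ≤ _ := Nat.mul_le_mul_right _ h1

/-- Cyclic shifts of the alphabet preserve balance, so no value at `s` is more frequent than `0`. -/
lemma card_balancedArrangements_le (Q r : ℕ) (s : C) :
    (balancedArrangements C Q r).card ≤
      ((balancedArrangements C Q r).filter fun w => w s = 0).card * (Q + 1) := by
  have h := Finset.card_le_mul_card_image_of_maps_to (f := fun w : C → Fin (Q + 1) => w s)
    (s := balancedArrangements C Q r) (t := Finset.univ) (fun _ _ => Finset.mem_univ _)
    ((balancedArrangements C Q r).filter fun w => w s = 0).card fun b _ => ?_
  · simpa using h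
  · refine Finset.card_le_card_of_injOn (fun w c => w c - b) (fun w hw => ?_) fun w _ w' _ h => ?_
    · obtain ⟨hw, hb⟩ := Finset.mem_filter.1 hw
      refine Finset.mem_filter.2 ⟨?_, by simp [hb]⟩
      rw [mem_balancedArrangements] at hw ⊢
      intro b'
      rw [← hw (b' + b)]
      congr 1
      ext c
      simp [sub_eq_iff_eq_add]
    · funext c
      exact sub_left_injective (congrFun h c)

/-- Exchange `c` with another place that carries a different symbol; as `r ≥ 2`, this place can be
chosen away from `s`. -/
lemma exists_balancedArrangement_ne {Q r : ℕ} (hQ : 1 ≤ Q) (hr : 2 ≤ r) {w : C → Fin (Q + 1)}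
    (hw : w ∈ balancedArrangements C Q r) {s c : C} (hc : c ≠ s) :
    ∃ w' ∈ balancedArrangements C Q r, w' s = w s ∧ w' c ≠ w c := by
  have : Nontrivial (Fin (Q + 1)) := Fin.nontrivial_iff_two_le.2 (by omega)
  obtain ⟨b, hb⟩ := exists_ne (w c)
  have hcard := mem_balancedArrangements.1 hw b
  obtain ⟨c', hc', hne⟩ := Finset.exists_mem_ne (by rw [hcard]; omega) s
    (s := Finset.univ.filter fun c => w c = b)
  have hc'b := (Finset.mem_filter.1 hc').2
  refine ⟨w ∘ Equiv.swap c c', ?_, ?_, ?_⟩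
  · rw [mem_balancedArrangements] at hw ⊢
    intro b'
    rw [← hw b']
    exact Finset.card_equiv (Equiv.swap c c') fun i => by simp
  · rw [Function.comp_apply, Equiv.swap_apply_of_ne_of_ne hc.symm hne.symm]
  · rw [Function.comp_apply, Equiv.swap_apply_left, hc'b]
    exact hb

/-- There are sufficiently rich families of balanced arrangements of any moderate size. -/
theorem exists_arrangements {Q r n : ℕ} (hQ : 1 ≤ Q) (hr : 2 ≤ r)
    (hC : Fintype.card C = (Q + 1) * r) (s : C) (hn : Fintype.card C ≤ n)
    (hn' : n * ((Q + 1) * (r + 1) ^ ((Q + 1) ^ 2)) ≤ (Q + 1) ^ Fintype.card C) :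
    ∃ τ : Fin n → C → Fin (Q + 1), Function.Injective τ ∧ (∀ a, τ a s = 0) ∧
      (∀ a b, (Finset.univ.filter fun c => τ a c = b).card = r) ∧
      ∀ c ≠ s, ∃ a a', τ a c ≠ τ a' c := by
  set A := (balancedArrangements C Q r).filter fun w => w s = 0 with hA
  have hnA : n ≤ A.card := by
    have h1 := pow_le_card_balancedArrangements hC
    have h2 := card_balancedArrangements_le Q r s
    refine Nat.le_of_mul_le_mul_right (c := (Q + 1) * (r + 1) ^ ((Q + 1) ^ 2)) ?_ (by positivity)
    calc _ ≤ _ := hn'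
      _ ≤ _ := h1
      _ ≤ A.card * (Q + 1) * (r + 1) ^ ((Q + 1) ^ 2) := Nat.mul_le_mul_right _ h2
      _ = _ := by ring
  have hCpos : 0 < Fintype.card C := Fintype.card_pos_iff.2 ⟨s⟩
  obtain ⟨w₀, hw₀⟩ := Finset.card_pos.1 (show 0 < A.card by omega)
  obtain ⟨hw₀b, hw₀s⟩ := Finset.mem_filter.1 hw₀
  have hex : ∀ c, ∃ w ∈ A, c ≠ s → w c ≠ w₀ c := by
    intro c
    by_cases hc : c = s
    · exact ⟨w₀, hw₀, fun h => absurd hc h⟩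
    · obtain ⟨w, hw, hws, hwc⟩ := exists_balancedArrangement_ne hQ hr hw₀b hc
      exact ⟨w, Finset.mem_filter.2 ⟨hw, hws.trans hw₀s⟩, fun _ => hwc⟩
  choose w hwA hwne using hex
  -- `w₀` takes the slot of `s`, so these witnesses that no other place is constant number at most
  -- `Fintype.card C`. They are then completed to `n` arrangements.
  set R : Finset (C → Fin (Q + 1)) := Finset.univ.image fun c => if c = s then w₀ else w c with hR
  have hRA : R ⊆ A := by
    intro v hv
    obtain ⟨c, -, rfl⟩ := Finset.mem_image.1 hv
    split_ifs
    exacts [hw₀, hwA c]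
  obtain ⟨T, hRT, hTA, hT⟩ := Finset.exists_subsuperset_card_eq hRA
    (Finset.card_image_le.trans hn) hnA
  set e := (T.equivFinOfCardEq hT).symm
  have hτ : ∀ v ∈ T, ∃ a, (e a : C → Fin (Q + 1)) = v := fun v hv =>
    ⟨e.symm ⟨v, hv⟩, by rw [Equiv.apply_symm_apply]⟩
  refine ⟨fun a => e a, fun a a' h => e.injective (Subtype.ext h), fun a => ?_, fun a b => ?_,
    fun c hc => ?_⟩
  · exact (Finset.mem_filter.1 (hTA (e a).2)).2
  · exact mem_balancedArrangements.1 (Finset.mem_filter.1 (hTA (e a).2)).1 b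
  · obtain ⟨a, ha⟩ := hτ w₀ (hRT (Finset.mem_image.2 ⟨s, Finset.mem_univ s, if_pos rfl⟩))
    obtain ⟨a', ha'⟩ := hτ (w c) (hRT (Finset.mem_image.2 ⟨c, Finset.mem_univ c, if_neg hc⟩))
    refine ⟨a', a, ?_⟩
    simp only [ha, ha']
    exact hwne c hc

end Arrangements

/-! ## Periodic arrays -/

lemma exists_mem_box_cast_eq {d N : ℕ} [NeZero N] (c : Fin d → ZMod N) :
    ∃ t ∈ Fintype.piFinset fun _ : Fin d => Finset.Ico (-1 : ℤ) (N - 1),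
      (fun i => ((t i : ℤ) : ZMod N)) = c := by
  have hN : (0 : ℤ) < N := by exact_mod_cast NeZero.pos N
  refine ⟨fun i => (((c i).val : ℤ) + 1) % N - 1, ?_, funext fun i => ?_⟩
  · rw [Fintype.mem_piFinset]
    intro i
    have h1 := Int.emod_nonneg (((c i).val : ℤ) + 1) hN.ne'
    have h2 := Int.emod_lt_of_pos (((c i).val : ℤ) + 1) hN
    rw [Finset.mem_Ico]
    constructor <;> omega
  · rw [Int.cast_sub, ZMod.intCast_mod]
    simp

lemma eq_of_mem_box_of_cast_eq {d N : ℕ} {t t' : Fin d → ℤ}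
    (ht : t ∈ Fintype.piFinset fun _ : Fin d => Finset.Ico (-1 : ℤ) (N - 1))
    (ht' : t' ∈ Fintype.piFinset fun _ : Fin d => Finset.Ico (-1 : ℤ) (N - 1))
    (h : (fun i => ((t i : ℤ) : ZMod N)) = fun i => ((t' i : ℤ) : ZMod N)) : t = t' := by
  rw [Fintype.mem_piFinset] at ht ht'
  funext i
  have h1 := Finset.mem_Ico.1 (ht i)
  have h2 := Finset.mem_Ico.1 (ht' i)
  have h3 := (ZMod.intCast_eq_intCast_iff_dvd_sub _ _ _).1 (congrFun h i)
  have h4 := Int.eq_zero_of_abs_lt_dvd h3 (by rw [abs_lt]; constructor <;> omega)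
  omega

/-! ## Numerical estimates -/

lemma eventually_mul_pow_le_exp {δ : ℝ} (hδ : 0 < δ) (c : ℝ) (e : ℕ) :
    ∀ᶠ L : ℕ in atTop, c * ((L : ℝ) + 1) ^ e ≤ Real.exp (δ * L) := by
  have h1 := (isLittleO_pow_exp_pos_mul_atTop e hδ).bound
    (show (0 : ℝ) < ((|c| + 1) * 2 ^ e)⁻¹ by positivity)
  have h2 := tendsto_natCast_atTop_atTop (R := ℝ) |>.eventually h1
  filter_upwards [h2, eventually_ge_atTop 1] with L hL hL1
  have hL1' : (1 : ℝ) ≤ L := by exact_mod_cast hL1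
  rw [Real.norm_of_nonneg (by positivity), Real.norm_of_nonneg (Real.exp_pos _).le,
    inv_mul_eq_div, le_div_iff₀ (by positivity)] at hL
  have h3 : ((L : ℝ) + 1) ^ e ≤ (2 * L) ^ e := pow_le_pow_left₀ (by positivity) (by linarith) _
  calc c * ((L : ℝ) + 1) ^ e ≤ (|c| + 1) * (2 * L) ^ e := by
        refine mul_le_mul (by linarith [le_abs_self c]) h3 (by positivity) (by positivity)
    _ = (L : ℝ) ^ e * ((|c| + 1) * 2 ^ e) := by rw [mul_pow]; ring
    _ ≤ _ := hL

lemma exists_side {d : ℕ} (hd : 1 ≤ d) {h : ℝ} (hpos : 0 < h) (n m : ℕ) (hm : 0 < m) :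
    ∃ N r : ℕ, 3 ≤ N ∧ n + 1 ∣ N ∧ 2 ≤ r ∧
      N ^ d = (⌊Real.exp (h * (m : ℝ) ^ d)⌋₊ + 1) * r ∧
      N ^ d ≤ ⌊Real.exp (h * ((m * N : ℕ) : ℝ) ^ d)⌋₊ + 1 ∧
      (⌊Real.exp (h * ((m * N : ℕ) : ℝ) ^ d)⌋₊ + 1) * ((⌊Real.exp (h * (m : ℝ) ^ d)⌋₊ + 1) *
        (r + 1) ^ ((⌊Real.exp (h * (m : ℝ) ^ d)⌋₊ + 1) ^ 2)) ≤
        (⌊Real.exp (h * (m : ℝ) ^ d)⌋₊ + 1) ^ (N ^ d) := by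
  set x : ℝ := h * (m : ℝ) ^ d with hx
  have hx0 : 0 < x := by positivity
  set q := ⌊Real.exp x⌋₊ + 1 with hq
  have hqpos : 0 < q := Nat.succ_pos _
  have hxq : Real.exp x < q := by rw [hq]; push_cast; exact Nat.lt_floor_add_one _
  -- This strict gap, due to rounding up in `q`, gives the exponential factor that absorbs all
  -- polynomial losses.
  have hδ : 0 < Real.log q - x := by
    rw [sub_pos, Real.lt_log_iff_exp_lt (by exact_mod_cast hqpos)]
    exact hxq
  have e1 := eventually_mul_pow_le_exp hδ (2 * q) (q ^ 2)
  have e2 := eventually_mul_pow_le_exp hx0 1 1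
  obtain ⟨L₀, hL₀⟩ := eventually_atTop.1 (e1.and e2)
  set j := L₀ + 3 with hj
  -- The factor `n + 1` serves universality, `q` makes `N ^ d` divisible by the number of symbols,
  -- and `j` makes the side large.
  set N := (n + 1) * q * j with hN
  have hjN : j ≤ N := Nat.le_mul_of_pos_left j (Nat.mul_pos n.succ_pos hqpos)
  have hNL : N ≤ N ^ d := Nat.le_self_pow (by omega) N
  obtain ⟨d', rfl⟩ : ∃ d', d = d' + 1 := ⟨d - 1, by omega⟩
  set r := N ^ d' * ((n + 1) * j) with hr
  have hLr : N ^ (d' + 1) = q * r := by rw [pow_succ, hr]; nth_rw 2 [hN]; ring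
  have hNpos : 0 < N := by omega
  have hr2 : 2 ≤ r := by
    have h1 : 0 < N ^ d' := pow_pos hNpos _
    have h2 : j ≤ (n + 1) * j := Nat.le_mul_of_pos_left j n.succ_pos
    have h3 : (n + 1) * j ≤ r := Nat.le_mul_of_pos_left _ h1
    omega
  obtain ⟨h1, h2⟩ := hL₀ (N ^ (d' + 1)) (by omega)
  have hexp : h * ((m * N : ℕ) : ℝ) ^ (d' + 1) = x * ((N ^ (d' + 1) : ℕ) : ℝ) := by
    rw [hx]; push_cast; rw [mul_pow]; ring
  refine ⟨N, r, by omega, ⟨q * j, by rw [hN]; ring⟩, hr2, hLr, ?_⟩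
  rw [hexp]
  set L := N ^ (d' + 1) with hL
  have hfl := Nat.floor_le (Real.exp_pos (x * (L : ℝ))).le
  have hfl' := Nat.lt_floor_add_one (Real.exp (x * (L : ℝ)))
  have hrL : r ≤ L := by rw [hLr]; exact Nat.le_mul_of_pos_left r hqpos
  refine ⟨?_, ?_⟩
  · rw [one_mul, pow_one] at h2
    have h3 : (L : ℝ) ≤ (⌊Real.exp (x * (L : ℝ))⌋₊ : ℝ) + 1 := by linarith
    exact_mod_cast h3
  · have hone : (1 : ℝ) ≤ Real.exp (x * L) := Real.one_le_exp (by positivity)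
    have h4 : (⌊Real.exp (x * (L : ℝ))⌋₊ : ℝ) + 1 ≤ 2 * Real.exp (x * L) := by linarith
    have h5 : ((r : ℝ) + 1) ^ q ^ 2 ≤ ((L : ℝ) + 1) ^ q ^ 2 :=
      pow_le_pow_left₀ (by positivity) (by have : (r : ℝ) ≤ L := by exact_mod_cast hrL
                                           linarith) _
    have hqR : (0 : ℝ) < q := by exact_mod_cast hqpos
    have h6 : ((⌊Real.exp (x * (L : ℝ))⌋₊ : ℝ) + 1) * ((q : ℝ) * ((r : ℝ) + 1) ^ q ^ 2) ≤
        (q : ℝ) ^ L := by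
      calc _ ≤ 2 * Real.exp (x * L) * ((q : ℝ) * ((L : ℝ) + 1) ^ q ^ 2) := by gcongr
        _ = Real.exp (x * L) * (2 * q * ((L : ℝ) + 1) ^ q ^ 2) := by ring
        _ ≤ Real.exp (x * L) * Real.exp ((Real.log q - x) * L) := by gcongr
        _ = (q : ℝ) ^ L := by
          rw [← Real.exp_add, ← add_mul, add_sub_cancel, mul_comm, Real.exp_nat_mul,
            Real.exp_log hqR]
    exact_mod_cast h6

/-! ## Existence of block towers -/

/-- The sides of the cubes of a tower with prescribed ratios. -/
def sideSeq (f : ℕ → ℕ → ℕ) : ℕ → ℕ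
  | 0 => 1
  | n + 1 => sideSeq f n * f n (sideSeq f n)

theorem BlockTower.exists_of_lt_log {d : ℕ} (hd : 1 ≤ d) {k : ℕ} (hk : 0 < k) {h : ℝ}
    (hpos : 0 < h) (hlt : h < Real.log k) :
    ∃ B : BlockTower d k, (∀ n, n + 1 ∣ B.N n) ∧
      ∀ n, B.Q n = ⌊Real.exp (h * (B.m n : ℝ) ^ d)⌋₊ := by
  -- Stated for `m + 1` so that positivity is automatic and the choice is total; the actual side `M
  -- n` enters as `M n - 1`.
  have hside := fun n m => exists_side hd hpos n (m + 1) m.succ_pos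
  choose f r hf3 hfdvd hr2 hfr hfle hfpow using hside
  set f' : ℕ → ℕ → ℕ := fun n m => f n (m - 1) with hf'
  set M := sideSeq f' with hM
  have hMpos : ∀ n, 0 < M n := by
    intro n
    induction n with
    | zero => exact Nat.one_pos
    | succ n ih =>
      have := hf3 n (M n - 1)
      exact Nat.mul_pos ih (by change 0 < f n (M n - 1); omega)
  set N : ℕ → ℕ := fun n => f n (M n - 1) with hN
  set R : ℕ → ℕ := fun n => r n (M n - 1) with hR
  set Q : ℕ → ℕ := fun n => ⌊Real.exp (h * (M n : ℝ) ^ d)⌋₊ with hQ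
  have hM1 : ∀ n, M n - 1 + 1 = M n := fun n => Nat.sub_add_cancel (hMpos n)
  have hNcard : ∀ n, N n ^ d = (Q n + 1) * R n := fun n => by
    have := hfr n (M n - 1)
    rwa [hM1] at this
  have hQ1 : ∀ n, 1 ≤ Q n := fun n => by
    rw [hQ]
    exact Nat.le_floor (by rw [Nat.cast_one]; exact Real.one_le_exp (by positivity))
  have hNpos : ∀ n, 0 < N n := fun n => by have := hf3 n (M n - 1); simp only [hN]; omega
  have hτ : ∀ n, ∃ τ : Fin (Q (n + 1) + 1) → (Fin d → ZMod (N n)) → Fin (Q n + 1),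
      Function.Injective τ ∧ (∀ a, τ a 0 = 0) ∧
      (∀ a b, ((Fintype.piFinset fun _ : Fin d => Finset.Ico (-1 : ℤ) (N n - 1)).filter
        fun t => τ a (fun i => (t i : ZMod (N n))) = b).card = R n) ∧
      ∀ c ≠ 0, ∃ a a', τ a c ≠ τ a' c := by
    intro n
    have : NeZero (N n) := ⟨(hNpos n).ne'⟩
    have hcard : Fintype.card (Fin d → ZMod (N n)) = N n ^ d := by simp [ZMod.card]
    have h1 := hfle n (M n - 1)
    have h2 := hfpow n (M n - 1)
    rw [hM1] at h1 h2
    obtain ⟨τ, hinj, hz, hbal, hfree⟩ := exists_arrangements (C := Fin d → ZMod (N n))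
      (n := Q (n + 1) + 1) (hQ1 n) (hr2 n (M n - 1)) (hcard.trans (hNcard n)) 0
      (by rw [hcard]; exact h1) (by rw [hcard]; exact h2)
    refine ⟨τ, hinj, hz, fun a b => ?_, hfree⟩
    refine Eq.trans ?_ (hbal a b)
    refine Finset.card_bij (fun t _ i => (t i : ZMod (N n))) (fun t ht => ?_)
      (fun t ht t' ht' hh => ?_) fun c hc => ?_
    · exact Finset.mem_filter.2 ⟨Finset.mem_univ _, (Finset.mem_filter.1 ht).2⟩
    · exact eq_of_mem_box_of_cast_eq (Finset.mem_filter.1 ht).1 (Finset.mem_filter.1 ht').1 hh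
    · obtain ⟨t, ht, rfl⟩ := exists_mem_box_cast_eq c
      exact ⟨t, Finset.mem_filter.2 ⟨ht, (Finset.mem_filter.1 hc).2⟩, rfl⟩
  choose τ hinj hz hbal hfree using hτ
  -- Level `0` has `⌊exp h⌋ + 1` symbols, which fit into the alphabet because `exp h < k`.
  have hQ0 : Q 0 + 1 ≤ k := by
    have hkR : (0 : ℝ) < k := by exact_mod_cast hk
    have h1 : Real.exp h < k := (Real.lt_log_iff_exp_lt hkR).1 hlt
    have h2 : Q 0 < k := by
      rw [hQ]
      refine (Nat.floor_lt (Real.exp_pos _).le).2 ?_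
      change Real.exp (h * ((1 : ℕ) : ℝ) ^ d) < k
      simpa using h1
    omega
  let B : BlockTower d k :=
    { N := N
      three_le := fun n => hf3 n _
      Q := Q
      ι := Fin.castLE hQ0
      ι_injective := Fin.castLE_injective hQ0
      τ := fun n a t => τ n a fun i => (t i : ZMod (N n))
      τ_periodic := fun n a t v => by simp
      τ_zero := fun n a => (congrArg (τ n a) (funext fun _ => Int.cast_zero)).trans (hz n a)
      r := R
      r_pos := fun n => by have := hr2 n (M n - 1); simp only [hR]; omega
      balanced := hbal
      τ_injective := fun n a a' hne => by
        have : NeZero (N n) := ⟨(hNpos n).ne'⟩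
        obtain ⟨c, hc⟩ := Function.ne_iff.1 ((hinj n).ne hne)
        obtain ⟨t, ht, rfl⟩ := exists_mem_box_cast_eq c
        exact ⟨t, ht, hc⟩
      τ_free := fun n t ht => by
        have h0 : (fun i => ((t i : ℤ) : ZMod (N n))) = 0 := by
          by_contra hne
          obtain ⟨a, a', haa⟩ := hfree n _ hne
          exact haa (ht a a')
        have h1 : ∀ i, ∃ v, t i = (N n : ℤ) * v := fun i =>
          (ZMod.intCast_zmod_eq_zero_iff_dvd _ _).1 (congrFun h0 i)
        choose v hv using h1
        exact ⟨v, funext hv⟩ }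
  have hBm : ∀ n, B.m n = M n := by
    intro n
    induction n with
    | zero => rfl
    | succ n ih => rw [B.m_succ, ih]; rfl
  exact ⟨B, fun n => hfdvd n _, fun n => by rw [hBm]⟩

lemma lambdaLim_le_log {k : ℕ} (hk : 5 ≤ k) : lambdaLim k ≤ Real.log k := by
  have h := (lambdaSeq_antitone hk).le_of_tendsto (tendsto_lambdaSeq hk) 0
  simpa [lambdaSeq, pqSeq] using h

theorem mainTheorem2 (d : ℕ) (hd : 1 ≤ d) (k : ℕ) (hk : 5 ≤ k) (h : ℝ) (hpos : 0 < h)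
    (hlt : h < lambdaLim k) :
    ∃ x : (Fin d → ℤ) → Fin k,
      IsToeplitzArray x ∧
      IsStrictlyErgodic (Fin d → ℤ) (orbitClosure x).carrier ∧
      HasTopologicalEntropy (orbitClosure x) h ∧
      ∃ c : SubgroupChain (Fin d → ℤ), IsUniversalOdometer c ∧
        ∃ π : (orbitClosure x).carrier → Odometer c,
          IsMaximalEquicontinuousFactor (Fin d → ℤ) π := by
  obtain ⟨B, hN, hQ⟩ := BlockTower.exists_of_lt_log hd (by omega) hpos
    (hlt.trans_le (lambdaLim_le_log hk))
  exact ⟨B.array, B.array_isToeplitz, B.isStrictlyErgodic,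
    BlockTower.hasTopologicalEntropy hpos hQ hd, B.chain, B.isUniversalOdometer_chain hN,
    B.toOdometer, B.isMaximalEquicontinuousFactor_toOdometer⟩
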